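/- **Theorem 6.1.** Let $\bar M^{2m+1}(\phi,\xi,\eta,g)$ be a Kenmotsu manifold, i.e. a smooth Riemannian manifold with Riemannian connection $\bar\nabla$, a $(1,1)$-tensor field $\phi$, a vector field $\xi$ and a 1-form $\eta$ such that $\phi\xi=0$, $\eta\circ\phi=0$, $\phi^2X=-X+\eta(X)\xi$, $g(\phi X,Y)=-g(X,\phi Y)$, $\eta(X)=g(X,\xi)$, $\eta(\xi)=1$, $g(\phi X,\phi Y)=g(X,Y)-\eta(X)\eta(Y)$, $\bar\nabla_X\xi=X-\eta(X)\xi$ and $(\bar\nabla_X\phi)Y=g(\phi X,Y)\xi-\eta(Y)\phi X$ for all vector fields $X,Y$. Let $M_\perp$, $M_\theta$, $M_T$ be smooth manifolds with $\dim M_\perp=q$, $\dim M_\theta=2s+1$, $\dim M_T=2p$ ($p,q,s\ge 0$), let $M_2=M_\perp\times M_\theta$ (product of manifolds) carry a Riemannian metric $g_2$ and $M_T$ a Riemannian metric $g_T$, let $f:M_2\to(0,\infty)$ be smooth, and let $M=M_2\times_fM_T$ be the warped product $(M_2\times M_T,\ g_2+f^2g_T)$. Suppose that $M$ is isometrically immersed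 in $\bar M$. For $X\in T_xM$ let $PX$ be the component of $\phi X$ tangent to $M$, and let $\theta\in(0,\pi/2)$ be a constant. Suppose that $M$ is a skew CR-submanifold of order $1$ with slant angle $\theta$ and with $\xi$ tangent to $M_\theta$, with factors as follows: at every point of $M$, - the tangent space of $M_T$ is $\mathcal D^T=\ker(P^2+I)$ (so $M_T$ is invariant), - the tangent space of $M_\perp$ is $\mathcal D^\perp=\{X\in\ker P^2: X\perp\xi\}$ (so $M_\perp$ is anti-invariant), - the tangent space of $M_\theta$ is $\mathcal D^\theta\oplus\langle\xi\rangle$ with $\mathcal D^\theta=\ker(P^2+\cos^2\theta\, I)$ (so $M_\theta$ is slant with slant angle $\theta$, and $\xi$ is tangent to it). Let $h$ be the second fundamental form of $M$ in $\bar M$ and $\|h\|^2=\sum_{i,j}g(h(e_i,e_j),h(e_i,e_j))$ for an orthonormal basis $(e_i)$ of the tangent space of $M$. Let $\nabla^\perp\ln f$ and $\nabla^\theta\ln f$ be the components, tangent to $M_\perp$ and to $M_\theta$ respectively, of the gradient of $\ln f$ on $(M_2,g_2)$. Then, at every point of $M$, $$\|h\|^2\ \ge\ 2p\left[\|\nabla^\perp\ln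 f\|^2+(\csc^2\theta+\cot^2\theta)\left(\|\nabla^\theta\ln f\|^2-1\right)\right].$$ If equality holds at every point of $M$, then $M_2$ (that is, every leaf $M_2\times\{t\}$) is totally geodesic in $\bar M$, and $M_T$ (every leaf $\{y\}\times M_T$) is totally umbilical in $\bar M$. -/

import Mathlib

open Bundle Module
open scoped Manifold ContDiff

noncomputable section

/-! ### Tangent spaces -/

section TangentSpaces

variable {E H : Type*} [NormedAddCommGroup E] [NormedSpace ℝ E] [FiniteDimensional ℝ E]
  [TopologicalSpace H] {I : ModelWithCorners ℝ E H} {X : Type*} [TopologicalSpace X] [ChartedSpace H X]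

instance tangentSpace_finiteDimensional (x : X) : FiniteDimensional ℝ (TangentSpace I x) :=
  inferInstanceAs (FiniteDimensional ℝ E)

variable [RiemannianBundle (fun x : X => TangentSpace I x)]

instance tangentSpace_hasOrthogonalProjection (x : X) (K : Submodule ℝ (TangentSpace I x)) :
    K.HasOrthogonalProjection :=
  haveI : FiniteDimensional ℝ K := FiniteDimensional.finiteDimensional_submodule K
  Submodule.HasOrthogonalProjection.ofCompleteSpace K

end TangentSpaces

/-! ### Kenmotsu manifolds -/

section Kenmotsu

variable {E H : Type*} [NormedAddCommGroup E] [NormedSpace ℝ E] [FiniteDimensional ℝ E]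
  [TopologicalSpace H] {I : ModelWithCorners ℝ E H}
  {X : Type*} [TopologicalSpace X] [ChartedSpace H X] [IsManifold I ∞ X]
  [RiemannianBundle (fun x : X => TangentSpace I x)]

/-- `nabla` is the Riemannian (Levi-Civita) connection of the metric of `X`: it is metric,
`v(g(Y, Z)) = g(∇_v Y, Z) + g(Y, ∇_v Z)` for vector fields `Y`, `Z` differentiable at `x` and
`v ∈ T_x X`, and it is torsion free. Recall that `nabla Y x v` is `(∇_v Y)(x)`. -/
structure IsRiemannianConnection
    (nabla : CovariantDerivative I E (fun x : X => TangentSpace I x)) : Prop where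
  metric (x : X) (v : TangentSpace I x) (Y Z : (x : X) → TangentSpace I x)
    (hY : MDifferentiableAt I (I.prod 𝓘(ℝ, E))
      (fun y => TotalSpace.mk' E (E := fun x : X => TangentSpace I x) y (Y y)) x)
    (hZ : MDifferentiableAt I (I.prod 𝓘(ℝ, E))
      (fun y => TotalSpace.mk' E (E := fun x : X => TangentSpace I x) y (Z y)) x) :
    mvfderiv I (fun y => (inner ℝ (Y y) (Z y) : ℝ)) x v =
      inner ℝ (nabla Y x v) (Z x) + inner ℝ (Y x) (nabla Z x v)
  torsion : nabla.torsion = 0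

variable (I X) in
/-- An almost contact metric structure `(φ, ξ, η)` on the Riemannian manifold `X`. -/
structure AlmostContactMetricStructure where
  /-- the `(1,1)` tensor field -/
  φ (x : X) : TangentSpace I x →L[ℝ] TangentSpace I x
  /-- the structure vector field -/
  ξ (x : X) : TangentSpace I x
  /-- the dual one-form -/
  η (x : X) : TangentSpace I x →L[ℝ] ℝ
  contMDiff_φ : ContMDiff I (I.prod 𝓘(ℝ, E →L[ℝ] E)) ∞
    (fun x => TotalSpace.mk' (E →L[ℝ] E)
      (E := fun x : X => TangentSpace I x →L[ℝ] TangentSpace I x) x (φ x))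
  contMDiff_ξ : ContMDiff I (I.prod 𝓘(ℝ, E)) ∞
    (fun x => TotalSpace.mk' E (E := fun x : X => TangentSpace I x) x (ξ x))
  φ_ξ (x : X) : φ x (ξ x) = 0
  η_φ (x : X) (v : TangentSpace I x) : η x (φ x v) = 0
  φ_φ (x : X) (v : TangentSpace I x) : φ x (φ x v) = -v + η x v • ξ x
  inner_φ_left (x : X) (v w : TangentSpace I x) : inner ℝ (φ x v) w = -inner ℝ v (φ x w)
  η_eq (x : X) (v : TangentSpace I x) : η x v = inner ℝ v (ξ x)
  η_ξ (x : X) : η x (ξ x) = 1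
  inner_φ_φ (x : X) (v w : TangentSpace I x) :
    inner ℝ (φ x v) (φ x w) = inner ℝ v w - η x v * η x w

/-- The almost contact metric structure `S` is Kenmotsu with respect to the Riemannian
connection `nabla`: `∇_v ξ = v - η(v) ξ` and `(∇_v φ) Y = g(φ v, Y) ξ - η(Y) φ v`, where
`(∇_v φ) Y = ∇_v (φ Y) - φ (∇_v Y)`. -/
structure AlmostContactMetricStructure.IsKenmotsu (S : AlmostContactMetricStructure I X)
    (nabla : CovariantDerivative I E (fun x : X => TangentSpace I x)) : Prop where
  nabla_ξ (x : X) (v : TangentSpace I x) : nabla S.ξ x v = v - S.η x v • S.ξ x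
  nabla_φ (x : X) (v : TangentSpace I x) (Y : (x : X) → TangentSpace I x)
    (hY : MDifferentiableAt I (I.prod 𝓘(ℝ, E))
      (fun x => TotalSpace.mk' E (E := fun x : X => TangentSpace I x) x (Y x)) x) :
    nabla (fun y => S.φ y (Y y)) x v - S.φ x (nabla Y x v) =
      (inner ℝ (S.φ x v) (Y x) : ℝ) • S.ξ x - S.η x (Y x) • S.φ x v

end Kenmotsu

/-! ### Immersed submanifolds

A submanifold of `X` is given by an immersion `ψ : N → X`; its tangent spaces are regarded as
subspaces of those of `X`. -/

section Submanifold

variable {E H : Type*} [NormedAddCommGroup E] [NormedSpace ℝ E] [FiniteDimensional ℝ E]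
  [TopologicalSpace H] {I : ModelWithCorners ℝ E H}
  {X : Type*} [TopologicalSpace X] [ChartedSpace H X] [IsManifold I ∞ X]
  [RiemannianBundle (fun x : X => TangentSpace I x)]
  {F G N : Type*} [NormedAddCommGroup F] [NormedSpace ℝ F] [TopologicalSpace G]
  (J : ModelWithCorners ℝ F G)
  [TopologicalSpace N] [ChartedSpace G N] [IsManifold J ∞ N]
  (nabla : CovariantDerivative I E (fun x : X => TangentSpace I x))

variable (I) in
/-- The tangent space at `y` of the immersed submanifold `ψ`. -/
def tangentImage (ψ : N → X) (y : N) : Submodule ℝ (TangentSpace I (ψ y)) :=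
  (mfderiv J I ψ y).range

/-- The covariant derivative at `y`, in the direction `v`, of a vector field `W` along `ψ`
(the pull-back of the connection `nabla`). In a local frame `E_a` of `TX` which is constant in
the trivialization of `TX` around `ψ y`, and with `W = ∑ W^a E_a`, this is
`∑ v(W^a) E_a + ∑ W^a ∇_{dψ v} E_a`. -/
def covDerivAlong (ψ : N → X) (W : (y : N) → TangentSpace I (ψ y)) (y : N)
    (v : TangentSpace J y) : TangentSpace I (ψ y) :=
  (trivializationAt E (fun x : X => TangentSpace I x) (ψ y)).symmL ℝ (ψ y)
      (mvfderiv J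
        (fun z => (trivializationAt E (fun x : X => TangentSpace I x) (ψ y) ⟨ψ z, W z⟩).2) y v)
    + nabla (FiberBundle.extend E (W y)) (ψ y) (mfderiv J I ψ y v)

/-- The second fundamental form `h(v, w)` of the immersed submanifold `ψ` at `y`: the component
normal to the submanifold of `∇_v (dψ Y)`, where `Y` is a local vector field of `N` with
`Y y = w`. -/
def secondFundamentalForm (ψ : N → X) (y : N) (v w : TangentSpace J y) :
    TangentSpace I (ψ y) :=
  (tangentImage I J ψ y)ᗮ.starProjection
    (covDerivAlong J nabla ψ
      (fun z => mfderiv J I ψ z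
        (FiberBundle.extend F (E := fun z : N => TangentSpace J z) w z)) y v)

variable (I) in
/-- A basis of `T_y N` which is orthonormal for the metric induced by the immersion `ψ`. -/
def orthonormalFrame (ψ : N → X) (y : N) :
    Fin (finrank ℝ (tangentImage I J ψ y)) → TangentSpace J y :=
  fun i => Classical.choose (stdOrthonormalBasis ℝ (tangentImage I J ψ y) i).2

/-- The squared norm `‖h‖² = ∑ g(h(e_i, e_j), h(e_i, e_j))` of the second fundamental form. -/
def normSqSecondFundamentalForm (ψ : N → X) (y : N) : ℝ :=
  ∑ i, ∑ j, ‖secondFundamentalForm J nabla ψ y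
    (orthonormalFrame I J ψ y i) (orthonormalFrame I J ψ y j)‖ ^ 2

/-- The mean curvature vector `H = (1 / dim N) trace h`. -/
def meanCurvature (ψ : N → X) (y : N) : TangentSpace I (ψ y) :=
  (1 / (finrank ℝ (tangentImage I J ψ y) : ℝ)) •
    ∑ i, secondFundamentalForm J nabla ψ y
      (orthonormalFrame I J ψ y i) (orthonormalFrame I J ψ y i)

/-- The immersed submanifold `ψ` is totally geodesic: `h = 0`. -/
def IsTotallyGeodesic (ψ : N → X) : Prop :=
  ∀ (y : N) (v w : TangentSpace J y), secondFundamentalForm J nabla ψ y v w = 0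

/-- The immersed submanifold `ψ` is totally umbilical: `h(v, w) = g(v, w) H`. -/
def IsTotallyUmbilical (ψ : N → X) : Prop :=
  ∀ (y : N) (v w : TangentSpace J y), secondFundamentalForm J nabla ψ y v w =
    (inner ℝ (mfderiv J I ψ y v) (mfderiv J I ψ y w) : ℝ) • meanCurvature J nabla ψ y

/-- `P`: the component tangent to the submanifold `ψ` of the image under `φ`. -/
def tangentialPart (S : AlmostContactMetricStructure I X) (ψ : N → X) (y : N) :
    TangentSpace I (ψ y) →L[ℝ] TangentSpace I (ψ y) :=
  (tangentImage I J ψ y).starProjection ∘L S.φ (ψ y)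

/-- The space of vectors `v` tangent to the submanifold `ψ` at `y` with `P² v = -c² v`. -/
def eigenDistribution (S : AlmostContactMetricStructure I X) (ψ : N → X) (c : ℝ) (y : N) :
    Submodule ℝ (TangentSpace I (ψ y)) where
  carrier := {v | v ∈ tangentImage I J ψ y ∧
    tangentialPart J S ψ y (tangentialPart J S ψ y v) = -(c ^ 2 • v)}
  add_mem' := by
    rintro v w ⟨hv, hv'⟩ ⟨hw, hw'⟩
    refine ⟨add_mem hv hw, ?_⟩
    rw [map_add, map_add, hv', hw', smul_add, neg_add]
  zero_mem' := ⟨zero_mem _, by rw [map_zero, map_zero, smul_zero, neg_zero]⟩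
  smul_mem' := by
    rintro a v ⟨hv, hv'⟩
    refine ⟨Submodule.smul_mem _ a hv, ?_⟩
    rw [map_smul, map_smul, hv', smul_neg, smul_comm]

end Submanifold

/-! ### Gradients -/

section Gradient

variable {E H : Type*} [NormedAddCommGroup E] [NormedSpace ℝ E] [FiniteDimensional ℝ E]
  [TopologicalSpace H] (I : ModelWithCorners ℝ E H)
  {X : Type*} [TopologicalSpace X] [ChartedSpace H X]
  [RiemannianBundle (fun x : X => TangentSpace I x)]
  {F G N : Type*} [NormedAddCommGroup F] [NormedSpace ℝ F] [TopologicalSpace G]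
  (J : ModelWithCorners ℝ F G) [TopologicalSpace N] [ChartedSpace G N]

/-- The gradient of the function `u`: `g(∇u, v) = v(u)`. -/
def riemannianGradient (u : X → ℝ) (x : X) : TangentSpace I x :=
  haveI : CompleteSpace (TangentSpace I x) := FiniteDimensional.complete ℝ _
  (InnerProductSpace.toDual ℝ (TangentSpace I x)).symm (mvfderiv I u x)

/-- The gradient of the function `u` on `X` along the submanifold `ψ` of `X`. -/
def gradientAlong (u : X → ℝ) (ψ : N → X) (y : N) : TangentSpace I (ψ y) :=
  (mfderiv J I ψ y).range.starProjection (riemannianGradient I u (ψ y))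

/-- The squared norm of the gradient of the function `u` on `X` along the submanifold `ψ`. -/
def normSqGradientAlong (u : X → ℝ) (ψ : N → X) (y : N) : ℝ :=
  ‖gradientAlong I J u ψ y‖ ^ 2

end Gradient

/-! ### Warped product skew CR-submanifolds -/

section WarpedProduct

variable {E H : Type*} [NormedAddCommGroup E] [NormedSpace ℝ E] [FiniteDimensional ℝ E]
  [TopologicalSpace H] {I : ModelWithCorners ℝ E H}
  {X : Type*} [TopologicalSpace X] [ChartedSpace H X] [IsManifold I ∞ X]
  [RiemannianBundle (fun x : X => TangentSpace I x)]
  {E₁ H₁ M₁ : Type*} [NormedAddCommGroup E₁] [NormedSpace ℝ E₁] [FiniteDimensional ℝ E₁]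
  [TopologicalSpace H₁] (I₁ : ModelWithCorners ℝ E₁ H₁)
  [TopologicalSpace M₁] [ChartedSpace H₁ M₁] [IsManifold I₁ ∞ M₁]
  {E₂ H₂ M₂ : Type*} [NormedAddCommGroup E₂] [NormedSpace ℝ E₂] [FiniteDimensional ℝ E₂]
  [TopologicalSpace H₂] (I₂ : ModelWithCorners ℝ E₂ H₂)
  [TopologicalSpace M₂] [ChartedSpace H₂ M₂] [IsManifold I₂ ∞ M₂]

/-- `χ` is an isometric immersion into `X` of the warped product `M₁ ×_f M₂`, that is, of
`M₁ × M₂` with the metric `g₁ + f² g₂`. -/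
structure IsWarpedProductImmersion
    [RiemannianBundle (fun x : M₁ => TangentSpace I₁ x)]
    [RiemannianBundle (fun x : M₂ => TangentSpace I₂ x)]
    (f : M₁ → ℝ) (χ : M₁ × M₂ → X) : Prop where
  contMDiff_f : ContMDiff I₁ 𝓘(ℝ, ℝ) ∞ f
  f_pos (y : M₁) : 0 < f y
  contMDiff : ContMDiff (I₁.prod I₂) I ∞ χ
  isometric (x : M₁ × M₂) (v w : TangentSpace (I₁.prod I₂) x) :
    (inner ℝ (mfderiv (I₁.prod I₂) I χ x v) (mfderiv (I₁.prod I₂) I χ x w) : ℝ) =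
      inner ℝ (mfderiv (I₁.prod I₂) I₁ Prod.fst x v) (mfderiv (I₁.prod I₂) I₁ Prod.fst x w)
      + f x.1 ^ 2 *
        inner ℝ (mfderiv (I₁.prod I₂) I₂ Prod.snd x v) (mfderiv (I₁.prod I₂) I₂ Prod.snd x w)

end WarpedProduct

section SkewCR

variable {E H : Type*} [NormedAddCommGroup E] [NormedSpace ℝ E] [FiniteDimensional ℝ E]
  [TopologicalSpace H] {I : ModelWithCorners ℝ E H}
  {X : Type*} [TopologicalSpace X] [ChartedSpace H X] [IsManifold I ∞ X]
  [RiemannianBundle (fun x : X => TangentSpace I x)]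
  {Ep Hp Mp : Type*} [NormedAddCommGroup Ep] [NormedSpace ℝ Ep] [FiniteDimensional ℝ Ep]
  [TopologicalSpace Hp] (Ip : ModelWithCorners ℝ Ep Hp)
  [TopologicalSpace Mp] [ChartedSpace Hp Mp] [IsManifold Ip ∞ Mp]
  {Eθ Hθ Mθ : Type*} [NormedAddCommGroup Eθ] [NormedSpace ℝ Eθ] [FiniteDimensional ℝ Eθ]
  [TopologicalSpace Hθ] (Iθ : ModelWithCorners ℝ Eθ Hθ)
  [TopologicalSpace Mθ] [ChartedSpace Hθ Mθ] [IsManifold Iθ ∞ Mθ]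
  {Et Ht Mt : Type*} [NormedAddCommGroup Et] [NormedSpace ℝ Et] [FiniteDimensional ℝ Et]
  [TopologicalSpace Ht] (It : ModelWithCorners ℝ Et Ht)
  [TopologicalSpace Mt] [ChartedSpace Ht Mt] [IsManifold It ∞ Mt]

/-- The submanifold `χ` of `X`, defined on `(Mp × Mθ) × Mt`, is a skew CR-submanifold of order 1
tangent to `ξ`, with slant angle `θ`: the eigenvalues of `P²` on `T_x M` are `-1`,
`-cos² θ` and `0`, so that `T_x M = D^T ⊕ D^⊥ ⊕ D^θ ⊕ ⟨ξ⟩`, and the tangent spaces of the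
factors `Mt`, `Mp` and `Mθ` are `D^T`, `D^⊥` and `D^θ ⊕ ⟨ξ⟩` respectively; thus `Mt` is
invariant, `Mp` is anti-invariant, and `Mθ` is slant and tangent to `ξ`. The distributions `D^T`,
`D^⊥`, `D^θ` are allowed to be zero. -/
structure IsSkewCRProduct (S : AlmostContactMetricStructure I X) (θ : ℝ)
    (χ : (Mp × Mθ) × Mt → X) : Prop where
  tangent_t (a : Mp) (b : Mθ) (t : Mt) :
    tangentImage I It (fun t' => χ ((a, b), t')) t =
      eigenDistribution ((Ip.prod Iθ).prod It) S χ 1 ((a, b), t)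
  tangent_p (a : Mp) (b : Mθ) (t : Mt) :
    tangentImage I Ip (fun a' => χ ((a', b), t)) a =
      eigenDistribution ((Ip.prod Iθ).prod It) S χ 0 ((a, b), t) ⊓ (ℝ ∙ S.ξ (χ ((a, b), t)))ᗮ
  tangent_θ (a : Mp) (b : Mθ) (t : Mt) :
    tangentImage I Iθ (fun b' => χ ((a, b'), t)) b =
      eigenDistribution ((Ip.prod Iθ).prod It) S χ (Real.cos θ) ((a, b), t)
        ⊔ (ℝ ∙ S.ξ (χ ((a, b), t)))

end SkewCR

end

noncomputable section

set_option linter.unusedSectionVars false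

/-! ### Differentiability of extensions of tangent vectors -/

section TangentBundle

variable {E H : Type*} [NormedAddCommGroup E] [NormedSpace ℝ E]
  [TopologicalSpace H] {I : ModelWithCorners ℝ E H}
  {X : Type*} [TopologicalSpace X] [ChartedSpace H X] [IsManifold I ∞ X]

/-! The lower bound is identically zero, so the inequality is the nonnegativity of `‖h‖²`, and
equality everywhere means `h = 0`. If `p = 0`, the factor `2p` vanishes. If `p > 0`, the Kenmotsu
structure forces `∇ ln f = ξ` on the base: `ξ` is a unit vector tangent to `M_θ` and orthogonal to
`M_⊥`, so the two gradient terms are `0` and `1 - 1`.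

The identity `∇ ln f = ξ` is `mvfderiv_log_eq_η`. Let `v`, `W` be tangent to `M_T` and `U` to `M_2`.
As `M_T` is invariant, `g(φW, U) = 0`. Differentiate this along `v`, using the Kenmotsu formula for
`∇φ`, `η(W) = 0`, and the warped product fact that the `M_T`-component of `∇_v U` is `U(ln f) v`.
The result is `g(φ ∇_v W, U) + g(φv, W) (η(U) - U(ln f)) = 0`. For fields extended constantly in
charts the first term is symmetric in `v`, `W`, the connection being torsion free, and the second is
skew, so the second vanishes. Taking `W = φv ≠ 0` at the point gives `U(ln f) = η(U)`.

In the equality case `M` is totally geodesic in the ambient manifold. In a warped product the leaves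
of the base are totally geodesic and those of the fibre are umbilical, and these properties then
pass to the ambient manifold (`isTotallyGeodesic_left`, `isTotallyUmbilical_right`).

The analytic input is a calculus of covariant derivatives of vector fields along a map. Each rule is
checked on restrictions of extended tangent vectors and propagated by `MDiffAlongAt.induction`. It
yields symmetry of the Hessian of a map (`hessianAlong_symm`) and the Koszul formula
(`two_inner_hessianAlong`). -/

theorem mdifferentiableAt_extend_tangent {x : X} (u : TangentSpace I x) :
    MDifferentiableAt I (I.prod 𝓘(ℝ, E))
      (fun x' => TotalSpace.mk' E (E := fun x : X => TangentSpace I x) x'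
        (FiberBundle.extend E u x')) x := by
  have := IsManifold.of_le (I := I) (M := X) (n := ∞) (m := 2) (by norm_cast)
  exact FiberBundle.mdifferentiableAt_extend I E u

end TangentBundle

/-! ### Vector fields along a map and their covariant derivative -/

section Along

variable {E H : Type*} [NormedAddCommGroup E] [NormedSpace ℝ E] [FiniteDimensional ℝ E]
  [TopologicalSpace H] {I : ModelWithCorners ℝ E H}
  {X : Type*} [TopologicalSpace X] [ChartedSpace H X] [IsManifold I ∞ X]
  {F G N : Type*} [NormedAddCommGroup F] [NormedSpace ℝ F] [TopologicalSpace G]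
  {J : ModelWithCorners ℝ F G}
  [TopologicalSpace N] [ChartedSpace G N]

variable (I J) in
/-- The vector field `W` along `ψ` is differentiable at `y`. -/
def MDiffAlongAt (ψ : N → X) (W : (z : N) → TangentSpace I (ψ z)) (y : N) : Prop :=
  MDifferentiableAt J (I.prod 𝓘(ℝ, E))
    (fun z => TotalSpace.mk' E (E := fun x : X => TangentSpace I x) (ψ z) (W z)) y

variable (I) in
/-- The coordinates of the vector field `W` along `ψ` in the trivialization of `TX` at `x₀`. -/
def coordAlong (ψ : N → X) (x₀ : X) (W : (z : N) → TangentSpace I (ψ z)) (z : N) : E :=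
  (trivializationAt E (fun x : X => TangentSpace I x) x₀ ⟨ψ z, W z⟩).2

variable {ψ : N → X} {y : N} {W W' : (z : N) → TangentSpace I (ψ z)} {g : N → ℝ}

theorem mdiffAlongAt_iff :
    MDiffAlongAt I J ψ W y ↔
      MDifferentiableAt J I ψ y ∧ MDifferentiableAt J 𝓘(ℝ, E) (coordAlong I ψ (ψ y) W) y :=
  mdifferentiableAt_totalSpace _ _

theorem eventually_mem_baseSet (hψ : ContinuousAt ψ y) :
    ∀ᶠ z in nhds y,
      ψ z ∈ (trivializationAt E (fun x : X => TangentSpace I x) (ψ y)).baseSet :=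
  hψ.eventually ((trivializationAt E (fun x : X => TangentSpace I x) (ψ y)).open_baseSet.mem_nhds
    (FiberBundle.mem_baseSet_trivializationAt' _))

theorem coordAlong_eq {x₀ : X} {z : N}
    (hz : ψ z ∈ (trivializationAt E (fun x : X => TangentSpace I x) x₀).baseSet) :
    coordAlong I ψ x₀ W z =
      (trivializationAt E (fun x : X => TangentSpace I x) x₀).continuousLinearMapAt ℝ (ψ z) (W z) := by
  rw [Trivialization.continuousLinearMapAt_apply, Trivialization.linearMapAt_apply, if_pos hz]
  rfl

/-- Only an identity of germs: the trivialization is fibrewise linear over its base set, which `ψ`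
is known to meet only near `y`. -/
theorem coordAlong_add_eventuallyEq (hψ : ContinuousAt ψ y) :
    coordAlong I ψ (ψ y) (fun z => W z + W' z) =ᶠ[nhds y]
      fun z => coordAlong I ψ (ψ y) W z + coordAlong I ψ (ψ y) W' z := by
  filter_upwards [eventually_mem_baseSet (I := I) hψ] with z hz
  simp only [coordAlong_eq hz, map_add]

theorem coordAlong_smul_eventuallyEq (hψ : ContinuousAt ψ y) :
    coordAlong I ψ (ψ y) (fun z => g z • W z) =ᶠ[nhds y]
      fun z => g z • coordAlong I ψ (ψ y) W z := by
  filter_upwards [eventually_mem_baseSet (I := I) hψ] with z hz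
  simp only [coordAlong_eq hz, map_smul]

theorem MDiffAlongAt.add (hW : MDiffAlongAt I J ψ W y) (hW' : MDiffAlongAt I J ψ W' y) :
    MDiffAlongAt I J ψ (fun z => W z + W' z) y := by
  rw [mdiffAlongAt_iff] at *
  exact ⟨hW.1, (hW.2.add hW'.2).congr_of_eventuallyEq
    (coordAlong_add_eventuallyEq hW.1.continuousAt)⟩

theorem MDiffAlongAt.smul (hg : MDifferentiableAt J 𝓘(ℝ, ℝ) g y) (hW : MDiffAlongAt I J ψ W y) :
    MDiffAlongAt I J ψ (fun z => g z • W z) y := by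
  rw [mdiffAlongAt_iff] at *
  exact ⟨hW.1, (hg.smul hW.2).congr_of_eventuallyEq
    (coordAlong_smul_eventuallyEq hW.1.continuousAt)⟩

theorem MDiffAlongAt.congr (hW : MDiffAlongAt I J ψ W y) (h : ∀ᶠ z in nhds y, W' z = W z) :
    MDiffAlongAt I J ψ W' y :=
  MDifferentiableAt.congr_of_eventuallyEq hW (h.mono fun z hz => by simp only [hz])

theorem MDiffAlongAt.comp {σ : (x : X) → TangentSpace I x}
    (hσ : MDifferentiableAt I (I.prod 𝓘(ℝ, E))
      (fun x => TotalSpace.mk' E (E := fun x : X => TangentSpace I x) x (σ x)) (ψ y))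
    (hψ : MDifferentiableAt J I ψ y) :
    MDiffAlongAt I J ψ (fun z => σ (ψ z)) y :=
  MDifferentiableAt.comp y hσ hψ

/-- Over the base set, the extension is the field with constant coordinates in the trivialization at
`x`; this makes it linear in `u` there. -/
theorem extend_eq_symmL {x : X} (u : TangentSpace I x) {x' : X}
    (h : x' ∈ (trivializationAt E (fun x : X => TangentSpace I x) x).baseSet) :
    FiberBundle.extend E u x' =
      (trivializationAt E (fun x : X => TangentSpace I x) x).symmL ℝ x'
        ((trivializationAt E (fun x : X => TangentSpace I x) x).continuousLinearMapAt ℝ x u) := by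
  have hx : x ∈ (trivializationAt E (fun x : X => TangentSpace I x) x).baseSet :=
    FiberBundle.mem_baseSet_trivializationAt' _
  rw [Trivialization.continuousLinearMapAt_apply, Trivialization.linearMapAt_apply, if_pos hx,
    Trivialization.symmL_apply _ h]
  rfl

/-- A property of differentiable vector fields along `ψ` which is local and compatible with sums
and products with functions holds as soon as it holds for the restrictions to `ψ` of the extensions
of tangent vectors. -/
theorem MDiffAlongAt.induction (P : ((z : N) → TangentSpace I (ψ z)) → Prop)
    (congr : ∀ W W' : (z : N) → TangentSpace I (ψ z), MDiffAlongAt I J ψ W y →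
      (∀ᶠ z in nhds y, W' z = W z) → P W → P W')
    (add : ∀ W W' : (z : N) → TangentSpace I (ψ z), MDiffAlongAt I J ψ W y →
      MDiffAlongAt I J ψ W' y → P W → P W' → P (fun z => W z + W' z))
    (smul : ∀ (g : N → ℝ) (W : (z : N) → TangentSpace I (ψ z)), MDifferentiableAt J 𝓘(ℝ, ℝ) g y →
      MDiffAlongAt I J ψ W y → P W → P (fun z => g z • W z))
    (extend : ∀ u : TangentSpace I (ψ y), P (fun z => FiberBundle.extend E u (ψ z)))
    (hW : MDiffAlongAt I J ψ W y) : P W := by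
  classical
  obtain ⟨hψ, hc⟩ := mdiffAlongAt_iff.1 hW
  set t := trivializationAt E (fun x : X => TangentSpace I x) (ψ y) with ht
  have hy : ψ y ∈ t.baseSet := FiberBundle.mem_baseSet_trivializationAt' _
  let b := finBasis ℝ E
  let u : Fin (finrank ℝ E) → TangentSpace I (ψ y) := fun i => t.symmL ℝ (ψ y) (b i)
  let c : Fin (finrank ℝ E) → N → ℝ := fun i z => (b.coord i).toContinuousLinearMap
    (coordAlong I ψ (ψ y) W z)
  have hcd : ∀ i, MDifferentiableAt J 𝓘(ℝ, ℝ) (c i) y := fun i =>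
    ((b.coord i).toContinuousLinearMap.mdifferentiableAt).comp y hc
  have hud : ∀ i, MDiffAlongAt I J ψ (fun z => FiberBundle.extend E (u i) (ψ z)) y := fun i =>
    MDiffAlongAt.comp (mdifferentiableAt_extend_tangent _) hψ
  -- Near `y`, `W` is a combination of extended basis vectors with its coordinates as coefficients.
  -- Differentiability is carried along with `P` because `add` requires it of both summands.
  have key : ∀ s : Finset (Fin (finrank ℝ E)),
      MDiffAlongAt I J ψ (fun z => ∑ i ∈ s, c i z • FiberBundle.extend E (u i) (ψ z)) y ∧
      P (fun z => ∑ i ∈ s, c i z • FiberBundle.extend E (u i) (ψ z)) := by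
    intro s
    induction s using Finset.induction_on with
    | empty =>
      -- No zero case is assumed of `P`; the empty sum is written as the zero function times an
      -- extension.
      have h0 : MDiffAlongAt I J ψ (fun z => (0 : ℝ) • FiberBundle.extend E
          (0 : TangentSpace I (ψ y)) (ψ z)) y :=
        MDiffAlongAt.smul mdifferentiableAt_const
          (MDiffAlongAt.comp (mdifferentiableAt_extend_tangent _) hψ)
      have h1 : P (fun z => (0 : ℝ) • FiberBundle.extend E (0 : TangentSpace I (ψ y)) (ψ z)) :=
        smul (fun _ => 0) _ mdifferentiableAt_const
          (MDiffAlongAt.comp (mdifferentiableAt_extend_tangent _) hψ) (extend 0)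
      simp only [zero_smul] at h0 h1
      simpa using And.intro h0 h1
    | insert i s hi ih =>
      simp only [Finset.sum_insert hi]
      have h1 := smul (c i) _ (hcd i) (hud i) (extend (u i))
      have h2 := MDiffAlongAt.smul (hcd i) (hud i)
      exact ⟨h2.add ih.1, add _ _ h2 ih.1 h1 ih.2⟩
  refine congr _ _ (key Finset.univ).1 ?_ (key Finset.univ).2
  filter_upwards [eventually_mem_baseSet (I := I) hψ.continuousAt] with z hz
  have h1 : W z = t.symmL ℝ (ψ z) (coordAlong I ψ (ψ y) W z) := by
    rw [coordAlong_eq hz, Trivialization.symmL_continuousLinearMapAt _ hz]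
  conv_lhs => rw [h1, ← b.sum_repr (coordAlong I ψ (ψ y) W z)]
  rw [map_sum]
  refine Finset.sum_congr rfl fun i _ => ?_
  rw [map_smul, extend_eq_symmL _ hz, Trivialization.continuousLinearMapAt_symmL _ hy]
  rfl

variable [IsManifold J ∞ N]
  {nabla : CovariantDerivative I E (fun x : X => TangentSpace I x)}

theorem covariantDerivative_congr {x : X} {σ τ : (x : X) → TangentSpace I x}
    (hσ : MDiffAlongAt I I (fun x : X => x) σ x) (h : ∀ᶠ z in nhds x, τ z = σ z) :
    nabla τ x = nabla σ x :=
  nabla.isCovariantDerivativeOnUniv.congr_of_eventuallyEq (hσ.congr h) hσ Filter.univ_mem h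

/-- `covDerivAlong` contains the term `nabla (extend (W y))`, so its additivity in `W` needs this.
Extension is additive near `x`, and the connection is local. -/
theorem covariantDerivative_extend_add {x : X} (u v : TangentSpace I x) :
    nabla (FiberBundle.extend E (u + v)) x =
      nabla (FiberBundle.extend E u) x + nabla (FiberBundle.extend E v) x := by
  have hu := mdifferentiableAt_extend_tangent u
  have hv := mdifferentiableAt_extend_tangent v
  rw [← nabla.isCovariantDerivativeOnUniv.add hu hv]
  refine covariantDerivative_congr (MDiffAlongAt.add (ψ := fun x : X => x) hu hv) ?_
  filter_upwards [eventually_mem_baseSet (I := I) (ψ := fun x : X => x) continuousAt_id] with z hz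
  simp only [Pi.add_apply, extend_eq_symmL _ hz, map_add]

theorem covariantDerivative_extend_smul {x : X} (c : ℝ) (u : TangentSpace I x) :
    nabla (FiberBundle.extend E (c • u)) x = c • nabla (FiberBundle.extend E u) x := by
  have hu := mdifferentiableAt_extend_tangent u
  rw [← nabla.isCovariantDerivativeOnUniv.smul_const c hu]
  refine covariantDerivative_congr
    (MDiffAlongAt.smul (ψ := fun x : X => x) (g := fun _ => c) mdifferentiableAt_const hu) ?_
  filter_upwards [eventually_mem_baseSet (I := I) (ψ := fun x : X => x) continuousAt_id] with z hz
  simp only [Pi.smul_apply, extend_eq_symmL _ hz, map_smul]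

theorem covDerivAlong_eq (v : TangentSpace J y) :
    covDerivAlong J nabla ψ W y v =
      (trivializationAt E (fun x : X => TangentSpace I x) (ψ y)).symmL ℝ (ψ y)
        (mvfderiv J (coordAlong I ψ (ψ y) W) y v)
      + nabla (FiberBundle.extend E (W y)) (ψ y) (mfderiv J I ψ y v) := rfl

theorem mvfderiv_congr {V : Type*} [NormedAddCommGroup V] [NormedSpace ℝ V] {k l : N → V}
    (h : k =ᶠ[nhds y] l) : mvfderiv J k y = mvfderiv J l y := by
  ext v
  simp only [mvfderiv, h.mfderiv_eq]
  rfl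

theorem covDerivAlong_congr (h : ∀ᶠ z in nhds y, W' z = W z) (v : TangentSpace J y) :
    covDerivAlong J nabla ψ W' y v = covDerivAlong J nabla ψ W y v := by
  have : coordAlong I ψ (ψ y) W' =ᶠ[nhds y] coordAlong I ψ (ψ y) W :=
    h.mono fun z hz => by simp only [coordAlong, hz]
  rw [covDerivAlong_eq, covDerivAlong_eq, mvfderiv_congr this, h.self_of_nhds]

theorem covDerivAlong_add (hW : MDiffAlongAt I J ψ W y) (hW' : MDiffAlongAt I J ψ W' y)
    (v : TangentSpace J y) :
    covDerivAlong J nabla ψ (fun z => W z + W' z) y v =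
      covDerivAlong J nabla ψ W y v + covDerivAlong J nabla ψ W' y v := by
  have h1 := mdiffAlongAt_iff.1 hW
  have h2 := mdiffAlongAt_iff.1 hW'
  simp only [covDerivAlong_eq]
  rw [mvfderiv_congr (coordAlong_add_eventuallyEq h1.1.continuousAt),
    mvfderiv_fun_add h1.2 h2.2, covariantDerivative_extend_add]
  simp only [add_apply, map_add]
  abel

/-- The derivative of `g` appears when the coordinates `g • W` are differentiated; returning from
coordinates to the fibre turns its coefficient back into `W y`. -/
theorem covDerivAlong_smul (hg : MDifferentiableAt J 𝓘(ℝ, ℝ) g y) (hW : MDiffAlongAt I J ψ W y)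
    (v : TangentSpace J y) :
    covDerivAlong J nabla ψ (fun z => g z • W z) y v =
      g y • covDerivAlong J nabla ψ W y v + mvfderiv J g y v • W y := by
  have h1 := mdiffAlongAt_iff.1 hW
  have hy := (eventually_mem_baseSet (I := I) h1.1.continuousAt).self_of_nhds
  simp only [covDerivAlong_eq]
  rw [mvfderiv_congr (coordAlong_smul_eventuallyEq h1.1.continuousAt),
    mvfderiv_fun_smul hg h1.2, covariantDerivative_extend_smul]
  simp only [add_apply, smul_apply,
    ContinuousLinearMap.smulRight_apply, map_add, map_smul]
  rw [coordAlong_eq hy, Trivialization.symmL_continuousLinearMapAt _ hy]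
  module

/-- The coordinates of the restricted extension are constant near `y`, so only the connection term
survives. -/
theorem covDerivAlong_extend (hψ : MDifferentiableAt J I ψ y) (u : TangentSpace I (ψ y))
    (v : TangentSpace J y) :
    covDerivAlong J nabla ψ (fun z => FiberBundle.extend E u (ψ z)) y v =
      nabla (FiberBundle.extend E u) (ψ y) (mfderiv J I ψ y v) := by
  have hy := (eventually_mem_baseSet (I := I) hψ.continuousAt).self_of_nhds
  have : coordAlong I ψ (ψ y) (fun z => FiberBundle.extend E u (ψ z)) =ᶠ[nhds y] fun _ =>
      (trivializationAt E (fun x : X => TangentSpace I x) (ψ y)).continuousLinearMapAt ℝ (ψ y) u := by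
    filter_upwards [eventually_mem_baseSet (I := I) hψ.continuousAt] with z hz
    rw [coordAlong_eq hz, extend_eq_symmL _ hz, Trivialization.continuousLinearMapAt_symmL _ hz]
  rw [covDerivAlong_eq, mvfderiv_congr this, mvfderiv_const, FiberBundle.extend_apply_self]
  simp

/-- A covariant derivative along the identity is the covariant derivative itself. -/
theorem covDerivAlong_id {x : X} {σ : (x : X) → TangentSpace I x}
    (hσ : MDiffAlongAt I I (fun x : X => x) σ x) (u : TangentSpace I x) :
    covDerivAlong I nabla (fun x : X => x) σ x u = nabla σ x u := by
  refine MDiffAlongAt.induction (ψ := fun x : X => x) (y := x) (J := I) (fun σ =>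
    covDerivAlong I nabla (fun x : X => x) σ x u = nabla σ x u) ?_ ?_ ?_ ?_ hσ
  · intro σ τ hσ h hP
    rw [covDerivAlong_congr h, hP, covariantDerivative_congr hσ h]
  · intro σ τ hσ hτ h1 h2
    rw [covDerivAlong_add hσ hτ, h1, h2]
    exact congrArg (fun L => L u) (nabla.isCovariantDerivativeOnUniv.add hσ hτ).symm
  · intro g σ hg hσ h1
    rw [covDerivAlong_smul hg hσ, h1]
    exact congrArg (fun L => L u) (nabla.isCovariantDerivativeOnUniv.leibniz hσ hg).symm
  · intro w
    refine (covDerivAlong_extend (ψ := fun x : X => x) mdifferentiableAt_id w u).trans ?_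
    congr 1
    exact congrArg (fun L => L u) (mfderiv_id (I := I) (x := x))

/-- The covariant derivative along `ψ` of the restriction of a vector field of `X`. -/
theorem covDerivAlong_comp {σ : (x : X) → TangentSpace I x}
    (hσ : MDiffAlongAt I I (fun x : X => x) σ (ψ y)) (hψ : MDifferentiableAt J I ψ y)
    (v : TangentSpace J y) :
    covDerivAlong J nabla ψ (fun z => σ (ψ z)) y v = nabla σ (ψ y) (mfderiv J I ψ y v) := by
  have h : MDifferentiableAt I 𝓘(ℝ, E) (coordAlong I (fun x : X => x) (ψ y) σ) (ψ y) :=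
    (mdiffAlongAt_iff.1 hσ).2
  have h1 : mvfderiv J (coordAlong I ψ (ψ y) (fun z => σ (ψ z))) y v =
      mvfderiv I (coordAlong I (fun x : X => x) (ψ y) σ) (ψ y) (mfderiv J I ψ y v) :=
    mfderiv_comp_apply (I' := I) (f := ψ) y h hψ v
  have h2 : mfderiv J I ψ y v = mfderiv I I (fun x : X => x) (ψ y) (mfderiv J I ψ y v) :=
    (congrArg (fun L => L (mfderiv J I ψ y v)) (mfderiv_id (I := I) (x := ψ y))).symm
  rw [← covDerivAlong_id hσ, covDerivAlong_eq, covDerivAlong_eq, h1]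
  exact congrArg (fun w => _ + nabla (FiberBundle.extend E (σ (ψ y))) (ψ y) w) h2

variable [RiemannianBundle (fun x : X => TangentSpace I x)]
  [IsContMDiffRiemannianBundle I ∞ E (fun x : X => TangentSpace I x)]

theorem MDiffAlongAt.inner (hW : MDiffAlongAt I J ψ W y) (hW' : MDiffAlongAt I J ψ W' y) :
    MDifferentiableAt J 𝓘(ℝ, ℝ) (fun z => (inner ℝ (W z) (W' z) : ℝ)) y :=
  MDifferentiableAt.inner_bundle (IB := I) (F := E) (E := fun x : X => TangentSpace I x) hW hW'

/-- The covariant derivative along a map is metric. -/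
theorem mvfderiv_inner_along (hnabla : IsRiemannianConnection nabla)
    (hW : MDiffAlongAt I J ψ W y) (hW' : MDiffAlongAt I J ψ W' y) (v : TangentSpace J y) :
    mvfderiv J (fun z => (inner ℝ (W z) (W' z) : ℝ)) y v =
      inner ℝ (covDerivAlong J nabla ψ W y v) (W' y) +
        inner ℝ (W y) (covDerivAlong J nabla ψ W' y v) := by
  have hψ := (mdiffAlongAt_iff.1 hW).1
  -- Both sides obey the same Leibniz rule in each argument, so each argument in turn is reduced to
  -- an extension; what remains is metric compatibility on `X` and the chain rule.
  refine MDiffAlongAt.induction (ψ := ψ) (y := y) (J := J) (fun W =>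
    mvfderiv J (fun z => (Inner.inner ℝ (W z) (W' z) : ℝ)) y v =
      Inner.inner ℝ (covDerivAlong J nabla ψ W y v) (W' y) +
        Inner.inner ℝ (W y) (covDerivAlong J nabla ψ W' y v)) ?_ ?_ ?_ ?_ hW
  · intro U V hU h hP
    rw [covDerivAlong_congr h, h.self_of_nhds, ← hP]
    congr 1
    exact mvfderiv_congr (h.mono fun z hz => by simp only [hz])
  · intro U V hU hV h1 h2
    simp only [inner_add_left]
    rw [mvfderiv_fun_add (hU.inner hW') (hV.inner hW'), covDerivAlong_add hU hV, inner_add_left,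
      add_apply, h1, h2]
    ring
  · intro g U hg hU h1
    simp only [real_inner_smul_left]
    rw [mvfderiv_fun_mul hg (hU.inner hW'), covDerivAlong_smul hg hU, inner_add_left]
    simp only [add_apply, smul_apply, h1, smul_eq_mul,
      real_inner_smul_left]
    ring
  · intro u
    have hu : MDiffAlongAt I J ψ (fun z => FiberBundle.extend E u (ψ z)) y :=
      MDiffAlongAt.comp (mdifferentiableAt_extend_tangent _) hψ
    refine MDiffAlongAt.induction (ψ := ψ) (y := y) (J := J) (fun W' =>
      mvfderiv J (fun z => (Inner.inner ℝ (FiberBundle.extend E u (ψ z)) (W' z) : ℝ)) y v =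
        Inner.inner ℝ (covDerivAlong J nabla ψ (fun z => FiberBundle.extend E u (ψ z)) y v) (W' y) +
        Inner.inner ℝ (FiberBundle.extend E u (ψ y)) (covDerivAlong J nabla ψ W' y v)) ?_ ?_ ?_ ?_ hW'
    · intro U V hU h hP
      rw [covDerivAlong_congr h, h.self_of_nhds, ← hP]
      congr 1
      exact mvfderiv_congr (h.mono fun z hz => by simp only [hz])
    · intro U V hU hV h1 h2
      simp only [inner_add_right]
      rw [mvfderiv_fun_add (hu.inner hU) (hu.inner hV), covDerivAlong_add hU hV, inner_add_right,
        add_apply, h1, h2]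
      ring
    · intro g U hg hU h1
      simp only [real_inner_smul_right]
      rw [mvfderiv_fun_mul hg (hu.inner hU), covDerivAlong_smul hg hU, inner_add_right]
      simp only [add_apply, smul_apply, h1, smul_eq_mul,
        real_inner_smul_right]
      ring
    · intro w
      have hw : MDiffAlongAt I J ψ (fun z => FiberBundle.extend E w (ψ z)) y :=
        MDiffAlongAt.comp (mdifferentiableAt_extend_tangent _) hψ
      rw [covDerivAlong_extend hψ, covDerivAlong_extend hψ]
      rw [← hnabla.metric _ _ _ _ (mdifferentiableAt_extend_tangent u)
        (mdifferentiableAt_extend_tangent w)]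
      exact mvfderiv_comp_apply (f := ψ)
        (g := fun x => (Inner.inner ℝ (FiberBundle.extend E u x) (FiberBundle.extend E w x) : ℝ)) y
        (MDiffAlongAt.inner (ψ := fun x : X => x) (mdifferentiableAt_extend_tangent u)
          (mdifferentiableAt_extend_tangent w)) hψ v

end Along

/-! ### The Kenmotsu identity along a map -/

section KenmotsuAlong

variable {E H : Type*} [NormedAddCommGroup E] [NormedSpace ℝ E] [FiniteDimensional ℝ E]
  [TopologicalSpace H] {I : ModelWithCorners ℝ E H}
  {X : Type*} [TopologicalSpace X] [ChartedSpace H X] [IsManifold I ∞ X]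
  [RiemannianBundle (fun x : X => TangentSpace I x)]
  {F G N : Type*} [NormedAddCommGroup F] [NormedSpace ℝ F] [TopologicalSpace G]
  {J : ModelWithCorners ℝ F G}
  [TopologicalSpace N] [ChartedSpace G N] [IsManifold J ∞ N]
  {ψ : N → X} {y : N} {W : (z : N) → TangentSpace I (ψ z)}
  {nabla : CovariantDerivative I E (fun x : X => TangentSpace I x)}

theorem MDiffAlongAt.map_φ (S : AlmostContactMetricStructure I X) (hW : MDiffAlongAt I J ψ W y) :
    MDiffAlongAt I J ψ (fun z => S.φ (ψ z) (W z)) y := by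
  have hψ := (mdiffAlongAt_iff.1 hW).1
  have hφ := (S.contMDiff_φ.mdifferentiable (by simp) (ψ y)).comp y hψ
  exact MDifferentiableAt.clm_bundle_apply (F₁ := E) (F₂ := E)
    (E₁ := fun x : X => TangentSpace I x) (E₂ := fun x : X => TangentSpace I x) hφ hW

/-- The covariant derivative of `φ W` for a vector field `W` along a map into a Kenmotsu
manifold. -/
theorem AlmostContactMetricStructure.IsKenmotsu.covDerivAlong_φ
    {S : AlmostContactMetricStructure I X} (hS : S.IsKenmotsu nabla)
    (hW : MDiffAlongAt I J ψ W y) (v : TangentSpace J y) :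
    covDerivAlong J nabla ψ (fun z => S.φ (ψ z) (W z)) y v =
      S.φ (ψ y) (covDerivAlong J nabla ψ W y v) +
        ((inner ℝ (S.φ (ψ y) (mfderiv J I ψ y v)) (W y) : ℝ) • S.ξ (ψ y) -
          S.η (ψ y) (W y) • S.φ (ψ y) (mfderiv J I ψ y v)) := by
  have hψ := (mdiffAlongAt_iff.1 hW).1
  refine MDiffAlongAt.induction (ψ := ψ) (y := y) (J := J) (fun W =>
    covDerivAlong J nabla ψ (fun z => S.φ (ψ z) (W z)) y v =
      S.φ (ψ y) (covDerivAlong J nabla ψ W y v) +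
        ((Inner.inner ℝ (S.φ (ψ y) (mfderiv J I ψ y v)) (W y) : ℝ) • S.ξ (ψ y) -
          S.η (ψ y) (W y) • S.φ (ψ y) (mfderiv J I ψ y v))) ?_ ?_ ?_ ?_ hW
  · intro U V hU h hP
    rw [covDerivAlong_congr h, h.self_of_nhds, ← hP]
    exact covDerivAlong_congr (h.mono fun z hz => by simp only [hz]) v
  · intro U V hU hV h1 h2
    simp only [map_add, inner_add_right]
    rw [covDerivAlong_add (hU.map_φ S) (hV.map_φ S), covDerivAlong_add hU hV, h1, h2, map_add]
    module
  · intro g U hg hU h1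
    simp only [map_smul, real_inner_smul_right]
    rw [covDerivAlong_smul hg (hU.map_φ S), covDerivAlong_smul hg hU, h1, map_add, map_smul,
      map_smul, smul_eq_mul]
    module
  · intro u
    have hu := mdifferentiableAt_extend_tangent u
    -- For an extension, `φ` applied to it is still the restriction of a vector field of `X`, so the
    -- Kenmotsu identity on `X` applies.
    rw [covDerivAlong_extend hψ, ← sub_eq_iff_eq_add',
      ← hS.nabla_φ _ _ _ hu, covDerivAlong_comp (σ := fun x => S.φ x (FiberBundle.extend E u x))
      (MDiffAlongAt.map_φ (ψ := fun x : X => x) S hu) hψ]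

end KenmotsuAlong

/-! ### Second derivatives in vector spaces -/

section Calculus

variable {E F D : Type*} [NormedAddCommGroup E] [NormedSpace ℝ E] [NormedAddCommGroup F]
  [NormedSpace ℝ F] [NormedAddCommGroup D] [NormedSpace ℝ D]

theorem fderiv_apply_const {A : F → F →L[ℝ] E} {a : F} (h : DifferentiableAt ℝ A a) (w v : F) :
    fderiv ℝ (fun b => A b w) a v = fderiv ℝ A a v w := by
  rw [fderiv_clm_apply h (differentiableAt_const _)]
  simp

theorem lieBracketWithin_const (u v : E) (s : Set E) (a : E) :
    VectorField.lieBracketWithin ℝ (fun _ => u) (fun _ => v) s a = 0 := by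
  simp [VectorField.lieBracketWithin]

/-- The second derivative of the composition with an affine map. -/
theorem fderiv_fderiv_comp_affine {f : F → E} {A : D → F} {L : D →L[ℝ] F} {a : D}
    (hA : ∀ b, HasFDerivAt A L b) (hf : ContDiffAt ℝ 2 f (A a)) (v w : D) :
    fderiv ℝ (fderiv ℝ (f ∘ A)) a v w = fderiv ℝ (fderiv ℝ f) (A a) (L v) (L w) := by
  have h1 : fderiv ℝ (f ∘ A) =ᶠ[nhds a] fun b => (fderiv ℝ f (A b)).comp L := by
    have h2 : ∀ᶠ c in nhds (A a), ContDiffAt ℝ 2 f c := hf.eventually (by simp)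
    filter_upwards [(hA a).continuousAt.eventually h2] with b hb
    exact ((hb.differentiableAt two_ne_zero).hasFDerivAt.comp b (hA b)).fderiv
  have h3 : DifferentiableAt ℝ (fderiv ℝ f) (A a) :=
    (hf.fderiv_right (m := 1) (by norm_num)).differentiableAt one_ne_zero
  rw [h1.fderiv_eq]
  have h4 : HasFDerivAt (fun b => fderiv ℝ f (A b)) ((fderiv ℝ (fderiv ℝ f) (A a)).comp L) a :=
    h3.hasFDerivAt.comp a (hA a)
  rw [(h4.clm_comp (hasFDerivAt_const L a)).fderiv]
  simp

end Calculus

/-! ### The Hessian of a map: symmetry and the Koszul formula -/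

section Hessian

variable {E H : Type*} [NormedAddCommGroup E] [NormedSpace ℝ E] [FiniteDimensional ℝ E]
  [TopologicalSpace H] {I : ModelWithCorners ℝ E H}
  {X : Type*} [TopologicalSpace X] [ChartedSpace H X] [IsManifold I ∞ X]
  {F G N : Type*} [NormedAddCommGroup F] [NormedSpace ℝ F] [TopologicalSpace G]
  {J : ModelWithCorners ℝ F G}
  [TopologicalSpace N] [ChartedSpace G N] [IsManifold J ∞ N]

variable (I J) in
/-- The image under `dψ` of the extension of a tangent vector `w` at `y`. -/
def pushExtend (ψ : N → X) {y : N} (w : TangentSpace J y) (z : N) : TangentSpace I (ψ z) :=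
  mfderiv J I ψ z (FiberBundle.extend F (E := fun z : N => TangentSpace J z) w z)

variable (J) in
/-- The covariant derivative `∇_v (dψ W)` where `W` is the extension of the tangent vector `w`. -/
def hessianAlong (nabla : CovariantDerivative I E (fun x : X => TangentSpace I x))
    (ψ : N → X) (y : N) (v w : TangentSpace J y) : TangentSpace I (ψ y) :=
  covDerivAlong J nabla ψ (pushExtend I J ψ w) y v

variable {ψ : N → X} {y : N}
  {nabla : CovariantDerivative I E (fun x : X => TangentSpace I x)}

theorem pushExtend_self (w : TangentSpace J y) : pushExtend I J ψ w y = mfderiv J I ψ y w := by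
  rw [pushExtend, FiberBundle.extend_apply_self]

/-- The field is the tangent map of `ψ` composed with a section differentiable at `y`. -/
theorem mdiffAlongAt_pushExtend (hψ : ContMDiff J I ∞ ψ) (w : TangentSpace J y) :
    MDiffAlongAt I J ψ (pushExtend I J ψ w) y := by
  have h := ((hψ.contMDiff_tangentMap (m := ∞) (by simp)).mdifferentiable (by simp)
    (TotalSpace.mk' F (E := fun z : N => TangentSpace J z) y (FiberBundle.extend F w y))).comp y
    (mdifferentiableAt_extend_tangent w)
  exact h

/-- Extensions are the coordinate fields of the chart at `y`. The trivialization at `y` acts as the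
identity on the fibre over `y`, so the constant coordinate vector is `w` itself. -/
theorem extend_eq_mfderiv_symm (w : TangentSpace J y) {z : N} (hz : z ∈ (chartAt G y).source) :
    FiberBundle.extend F (E := fun z : N => TangentSpace J z) w z =
      mfderivWithin 𝓘(ℝ, F) J (extChartAt J y).symm (Set.range J) (extChartAt J y z) w := by
  have := IsManifold.of_le (I := J) (M := N) (n := ∞) (m := 1) (by norm_cast)
  have hy : y ∈ (trivializationAt F (fun z : N => TangentSpace J z) y).baseSet :=
    FiberBundle.mem_baseSet_trivializationAt' _
  have h1 : (trivializationAt F (fun z : N => TangentSpace J z) y ⟨y, w⟩).2 = w := by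
    have h2 : (trivializationAt F (fun z : N => TangentSpace J z) y).continuousLinearMapAt ℝ y w
        = w := by
      rw [TangentBundle.continuousLinearMapAt_trivializationAt (mem_chart_source G y),
        mfderiv_extChartAt_self]
      rfl
    rwa [Trivialization.continuousLinearMapAt_apply, Trivialization.linearMapAt_apply,
      if_pos hy] at h2
  let t := trivializationAt F (fun z : N => TangentSpace J z) y
  have h3 : t.symm z (t ⟨y, w⟩).2 = t.symmL ℝ z (show F from w) :=
    (congrArg (t.symm z) h1).trans (Trivialization.symmL_apply (R := ℝ) t hz _).symm
  exact h3.trans (congrArg (fun L : F →L[ℝ] TangentSpace J z => L w)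
    (TangentBundle.symmL_trivializationAt hz))

theorem contDiffAt_writtenInExtChartAt [J.Boundaryless] (hψ : ContMDiff J I ∞ ψ) :
    ContDiffAt ℝ ∞ (writtenInExtChartAt J I y ψ) (extChartAt J y y) := by
  have := (contMDiffAt_iff.1 (hψ y)).2
  rwa [J.range_eq_univ, contDiffWithinAt_univ] at this

/-- The chain rule in charts: the derivative of the inverse chart makes the field, and that of the
target chart reads its coordinates. -/
theorem coordAlong_pushExtend [J.Boundaryless] (hψ : ContMDiff J I ∞ ψ) (w : TangentSpace J y) :
    coordAlong I ψ (ψ y) (pushExtend I J ψ w) =ᶠ[nhds y]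
      fun z => fderiv ℝ (writtenInExtChartAt J I y ψ) (extChartAt J y z) w := by
  have := IsManifold.of_le (I := J) (M := N) (n := ∞) (m := 1) (by norm_cast)
  have := IsManifold.of_le (I := I) (M := X) (n := ∞) (m := 1) (by norm_cast)
  filter_upwards [eventually_mem_baseSet (I := I) hψ.continuous.continuousAt,
    (chartAt G y).open_source.mem_nhds (mem_chart_source G y)] with z hz hz'
  have hzs : z ∈ (extChartAt J y).source := by rwa [extChartAt_source]
  have hzt := (extChartAt J y).map_source hzs
  have hsymm : (extChartAt J y).symm (extChartAt J y z) = z := (extChartAt J y).left_inv hzs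
  rw [coordAlong_eq hz, TangentBundle.continuousLinearMapAt_trivializationAt hz, pushExtend,
    extend_eq_mfderiv_symm w hz', J.range_eq_univ, mfderivWithin_univ, ← mfderiv_eq_fderiv]
  have d1 : MDifferentiableAt 𝓘(ℝ, F) J (extChartAt J y).symm (extChartAt J y z) := by
    have := mdifferentiableWithinAt_extChartAt_symm hzt
    rwa [J.range_eq_univ, mdifferentiableWithinAt_univ] at this
  have d2 : MDifferentiableAt J I ψ z := hψ.mdifferentiable (by simp) z
  have d3 : MDifferentiableAt I 𝓘(ℝ, E) (extChartAt I (ψ y)) (ψ z) := mdifferentiableAt_extChartAt hz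
  have d4 : MDifferentiableAt J 𝓘(ℝ, E) (extChartAt I (ψ y) ∘ ψ) z := d3.comp z d2
  have e1 := mfderiv_comp_apply_of_eq (extChartAt J y z) d4 d1 hsymm w
  have e2 := mfderiv_comp_apply z d3 d2
    (mfderiv 𝓘(ℝ, F) J (extChartAt J y).symm (extChartAt J y z) w)
  exact (e1.trans e2).symm

/-- The usual local formula, second derivative plus Christoffel term, from which symmetry and
restriction to slices are read off. -/
theorem hessianAlong_eq [J.Boundaryless] (hψ : ContMDiff J I ∞ ψ) (v w : TangentSpace J y) :
    hessianAlong J nabla ψ y v w =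
      (trivializationAt E (fun x : X => TangentSpace I x) (ψ y)).symmL ℝ (ψ y)
        (fderiv ℝ (fderiv ℝ (writtenInExtChartAt J I y ψ)) (extChartAt J y y) v w)
      + nabla (FiberBundle.extend E (mfderiv J I ψ y w)) (ψ y) (mfderiv J I ψ y v) := by
  have := IsManifold.of_le (I := J) (M := N) (n := ∞) (m := 1) (by norm_cast)
  rw [hessianAlong, covDerivAlong_eq, pushExtend_self, mvfderiv_congr (coordAlong_pushExtend hψ w)]
  congr 2
  have hd : DifferentiableAt ℝ (fderiv ℝ (writtenInExtChartAt J I y ψ)) (extChartAt J y y) :=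
    ((contDiffAt_writtenInExtChartAt hψ).fderiv_right (m := 1) (by norm_cast)).differentiableAt
      one_ne_zero
  have hd' : DifferentiableAt ℝ (fun a => fderiv ℝ (writtenInExtChartAt J I y ψ) a w)
      (extChartAt J y y) := hd.clm_apply (differentiableAt_const _)
  have hc : MDifferentiableAt J 𝓘(ℝ, F) (extChartAt J y) y :=
    mdifferentiableAt_extChartAt (mem_chart_source G y)
  have e1 := mfderiv_comp_apply (f := extChartAt J y) y hd'.mdifferentiableAt hc v
  refine e1.trans ?_
  rw [mfderiv_extChartAt_self, mfderiv_eq_fderiv]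
  exact fderiv_apply_const hd w v

/-- Pulled back to the chart, both fields are constant. -/
theorem mlieBracket_extend {x : X} (u v : TangentSpace I x) :
    VectorField.mlieBracket I (FiberBundle.extend E u) (FiberBundle.extend E v) x = 0 := by
  have := IsManifold.of_le (I := I) (M := X) (n := ∞) (m := 1) (by norm_cast)
  have key : ∀ w : TangentSpace I x,
      VectorField.mpullbackWithin 𝓘(ℝ, E) I (extChartAt I x).symm (FiberBundle.extend E w)
        (Set.range I) =ᶠ[nhdsWithin (extChartAt I x x) (Set.range I)] fun _ => w := by
    intro w
    filter_upwards [extChartAt_target_mem_nhdsWithin x] with a ha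
    have ha' : (extChartAt I x).symm a ∈ (chartAt H x).source := by
      rw [← extChartAt_source (I := I)]; exact (extChartAt I x).map_target ha
    rw [VectorField.mpullbackWithin_apply, extend_eq_mfderiv_symm w ha',
      (extChartAt I x).right_inv ha]
    exact (isInvertible_mfderivWithin_extChartAt_symm ha).inverse_apply_self _
  rw [← VectorField.mlieBracketWithin_univ, VectorField.mlieBracketWithin_apply, Set.preimage_univ,
    Set.univ_inter]
  have hb : VectorField.lieBracketWithin ℝ
      (VectorField.mpullbackWithin 𝓘(ℝ, E) I (extChartAt I x).symm (FiberBundle.extend E u)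
        (Set.range I))
      (VectorField.mpullbackWithin 𝓘(ℝ, E) I (extChartAt I x).symm (FiberBundle.extend E v)
        (Set.range I)) (Set.range I) (extChartAt I x x) = 0 := by
    have hm : extChartAt I x x ∈ Set.range I := by simp
    rw [(key u).lieBracketWithin_vectorField_eq_of_mem (key v) hm]
    exact lieBracketWithin_const _ _ _ _
  rw [hb]
  exact map_zero _

/-- Linearity in the direction is immediate from the definition; in the other slot it is later
reached through `hessianAlong_symm`. -/
theorem hessianAlong_add_left (v v' w : TangentSpace J y) :
    hessianAlong J nabla ψ y (v + v') w =
      hessianAlong J nabla ψ y v w + hessianAlong J nabla ψ y v' w := by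
  simp only [hessianAlong, covDerivAlong_eq, map_add]
  abel

theorem hessianAlong_smul_left (c : ℝ) (v w : TangentSpace J y) :
    hessianAlong J nabla ψ y (c • v) w = c • hessianAlong J nabla ψ y v w := by
  simp only [hessianAlong, covDerivAlong_eq, map_smul, smul_add]

/-- The restriction of an immersion of a product to a slice `ι`, given in the charts by an affine
map `A` with linear part `L`. -/
theorem hessianAlong_comp_affine [J.Boundaryless]
    {F' G' N' : Type*} [NormedAddCommGroup F'] [NormedSpace ℝ F'] [TopologicalSpace G']
    {J' : ModelWithCorners ℝ F' G'} [TopologicalSpace N'] [ChartedSpace G' N'] [IsManifold J' ∞ N']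
    [J'.Boundaryless] (hψ : ContMDiff J I ∞ ψ) {ι : N' → N} (hι : ContMDiff J' J ∞ ι) {y' : N'}
    {A : F' → F} {L : F' →L[ℝ] F} (hA : ∀ b, HasFDerivAt A L b)
    (hιA : ∀ a, ι ((extChartAt J' y').symm a) = (extChartAt J (ι y')).symm (A a))
    (hAy : A (extChartAt J' y' y') = extChartAt J (ι y') (ι y'))
    (hL : ∀ v : TangentSpace J' y', mfderiv J' J ι y' v = L v)
    (v w : TangentSpace J' y') :
    hessianAlong J' nabla (fun z => ψ (ι z)) y' v w =
      hessianAlong J nabla ψ (ι y') (mfderiv J' J ι y' v) (mfderiv J' J ι y' w) := by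
  have hψι : ContMDiff J' I ∞ (fun z => ψ (ι z)) := hψ.comp hι
  have e0 : writtenInExtChartAt J' I y' (fun z => ψ (ι z)) =
      writtenInExtChartAt J I (ι y') ψ ∘ A := by
    funext a
    simp only [writtenInExtChartAt, Function.comp_apply, hιA]
  have e1 : ∀ u : TangentSpace J' y', mfderiv J' I (fun z => ψ (ι z)) y' u =
      mfderiv J I ψ (ι y') (mfderiv J' J ι y' u) := fun u =>
    mfderiv_comp_apply y' (hψ.mdifferentiable (by simp) _) (hι.mdifferentiable (by simp) _) u
  have hf : ContDiffAt ℝ 2 (writtenInExtChartAt J I (ι y') ψ) (A (extChartAt J' y' y')) := by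
    rw [hAy]
    exact (contDiffAt_writtenInExtChartAt hψ).of_le (by norm_cast)
  rw [hessianAlong_eq hψι, hessianAlong_eq hψ, e0, e1, e1]
  congr 2
  refine (fderiv_fderiv_comp_affine hA hf v w).trans ?_
  rw [hAy, ← hL, ← hL]

variable [RiemannianBundle (fun x : X => TangentSpace I x)]

/-- The second derivative is symmetric, and the connection term is symmetric because the torsion
vanishes and the extensions commute. -/
theorem hessianAlong_symm [J.Boundaryless] (hnabla : IsRiemannianConnection nabla)
    (hψ : ContMDiff J I ∞ ψ) (v w : TangentSpace J y) :
    hessianAlong J nabla ψ y v w = hessianAlong J nabla ψ y w v := by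
  rw [hessianAlong_eq hψ, hessianAlong_eq hψ]
  congr 1
  · congr 1
    exact ((contDiffAt_writtenInExtChartAt hψ).isSymmSndFDerivAt
      (by simp only [minSmoothness_of_isRCLikeNormedField]; norm_cast)) v w
  · have h := nabla.torsion_apply_eq_extend (mfderiv J I ψ y v) (mfderiv J I ψ y w)
    rw [hnabla.torsion, mlieBracket_extend] at h
    simp only [FiberBundle.extend_apply_self, sub_zero, Pi.zero_apply, zero_apply] at h
    exact sub_eq_zero.1 h.symm

variable [IsContMDiffRiemannianBundle I ∞ E (fun x : X => TangentSpace I x)]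

/-- The Koszul formula. -/
theorem two_inner_hessianAlong [J.Boundaryless] (hnabla : IsRiemannianConnection nabla)
    (hψ : ContMDiff J I ∞ ψ) (u v w : TangentSpace J y) :
    2 * (inner ℝ (hessianAlong J nabla ψ y v w) (mfderiv J I ψ y u) : ℝ) =
      mvfderiv J (fun z => (inner ℝ (pushExtend I J ψ w z) (pushExtend I J ψ u z) : ℝ)) y v
      + mvfderiv J (fun z => (inner ℝ (pushExtend I J ψ v z) (pushExtend I J ψ u z) : ℝ)) y w
      - mvfderiv J (fun z => (inner ℝ (pushExtend I J ψ v z) (pushExtend I J ψ w z) : ℝ)) y u := by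
  have hd : ∀ w : TangentSpace J y, MDiffAlongAt I J ψ (pushExtend I J ψ w) y := fun w =>
    mdiffAlongAt_pushExtend hψ w
  have key : ∀ u v w : TangentSpace J y,
      mvfderiv J (fun z => (inner ℝ (pushExtend I J ψ v z) (pushExtend I J ψ w z) : ℝ)) y u =
      inner ℝ (hessianAlong J nabla ψ y u v) (mfderiv J I ψ y w) +
        inner ℝ (mfderiv J I ψ y v) (hessianAlong J nabla ψ y u w) := by
    intro u v w
    rw [mvfderiv_inner_along hnabla (hd v) (hd w), pushExtend_self, pushExtend_self]
    rfl
  rw [key, key, key, hessianAlong_symm hnabla hψ u v, hessianAlong_symm hnabla hψ u w,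
    hessianAlong_symm hnabla hψ w v,
    real_inner_comm (mfderiv J I ψ y w) (hessianAlong J nabla ψ y v u)]
  ring

end Hessian

/-! ### Products: tangent vectors, extensions and slices -/

section Product

variable {E H : Type*} [NormedAddCommGroup E] [NormedSpace ℝ E] [FiniteDimensional ℝ E]
  [TopologicalSpace H] {I : ModelWithCorners ℝ E H}
  {X : Type*} [TopologicalSpace X] [ChartedSpace H X] [IsManifold I ∞ X]
  {E₁ H₁ M₁ : Type*} [NormedAddCommGroup E₁] [NormedSpace ℝ E₁] [FiniteDimensional ℝ E₁]
  [TopologicalSpace H₁] {I₁ : ModelWithCorners ℝ E₁ H₁}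
  [TopologicalSpace M₁] [ChartedSpace H₁ M₁] [IsManifold I₁ ∞ M₁]
  {E₂ H₂ M₂ : Type*} [NormedAddCommGroup E₂] [NormedSpace ℝ E₂] [FiniteDimensional ℝ E₂]
  [TopologicalSpace H₂] {I₂ : ModelWithCorners ℝ E₂ H₂}
  [TopologicalSpace M₂] [ChartedSpace H₂ M₂] [IsManifold I₂ ∞ M₂]
  {nabla : CovariantDerivative I E (fun x : X => TangentSpace I x)}

/-- The tangent vector of a product with given components. -/
def tangentPair {x : M₁ × M₂} (v₁ : TangentSpace I₁ x.1) (v₂ : TangentSpace I₂ x.2) :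
    TangentSpace (I₁.prod I₂) x :=
  (v₁, v₂)

variable {x : M₁ × M₂}

theorem exists_tangentPair (v : TangentSpace (I₁.prod I₂) x) :
    ∃ v₁ v₂, v = tangentPair (x := x) v₁ v₂ :=
  ⟨v.1, v.2, rfl⟩

theorem tangentPair_add (v₁ w₁ : TangentSpace I₁ x.1) (v₂ w₂ : TangentSpace I₂ x.2) :
    tangentPair (v₁ + w₁) (v₂ + w₂) = tangentPair v₁ v₂ + tangentPair (x := x) w₁ w₂ := rfl

theorem tangentPair_smul (c : ℝ) (v₁ : TangentSpace I₁ x.1) (v₂ : TangentSpace I₂ x.2) :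
    tangentPair (c • v₁) (c • v₂) = c • tangentPair (x := x) v₁ v₂ := rfl

theorem tangentPair_zero :
    tangentPair (I₁ := I₁) (I₂ := I₂) (x := x) 0 0 = 0 := rfl

theorem mfderiv_fst_tangentPair (v₁ : TangentSpace I₁ x.1) (v₂ : TangentSpace I₂ x.2) :
    mfderiv (I₁.prod I₂) I₁ Prod.fst x (tangentPair v₁ v₂) = v₁ := by
  rw [mfderiv_fst]; rfl

theorem mfderiv_snd_tangentPair (v₁ : TangentSpace I₁ x.1) (v₂ : TangentSpace I₂ x.2) :
    mfderiv (I₁.prod I₂) I₂ Prod.snd x (tangentPair v₁ v₂) = v₂ := by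
  rw [mfderiv_snd]; rfl

theorem mfderiv_slice_left (y : M₁) (t : M₂) (v : TangentSpace I₁ y) :
    mfderiv I₁ (I₁.prod I₂) (fun y => (y, t)) y v = tangentPair (x := (y, t)) v 0 := by
  rw [mfderiv_prod_left]; rfl

theorem mfderiv_slice_right (y : M₁) (t : M₂) (v : TangentSpace I₂ t) :
    mfderiv I₂ (I₁.prod I₂) (fun t => (y, t)) t v = tangentPair (x := (y, t)) 0 v := by
  rw [mfderiv_prod_right]; rfl

/-- The chart of a product is the product of the charts, so its coordinate fields split. -/
theorem extend_tangentPair [I₁.Boundaryless] [I₂.Boundaryless]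
    (v₁ : TangentSpace I₁ x.1) (v₂ : TangentSpace I₂ x.2) :
    ∀ᶠ z in nhds x,
      FiberBundle.extend (E₁ × E₂) (E := fun z : M₁ × M₂ => TangentSpace (I₁.prod I₂) z)
        (tangentPair v₁ v₂) z =
      tangentPair (FiberBundle.extend E₁ (E := fun z : M₁ => TangentSpace I₁ z) v₁ z.1)
        (FiberBundle.extend E₂ (E := fun z : M₂ => TangentSpace I₂ z) v₂ z.2) := by
  have := IsManifold.of_le (I := I₁) (M := M₁) (n := ∞) (m := 1) (by norm_cast)
  have := IsManifold.of_le (I := I₂) (M := M₂) (n := ∞) (m := 1) (by norm_cast)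
  filter_upwards [((chartAt H₁ x.1).open_source.prod (chartAt H₂ x.2).open_source).mem_nhds
    ⟨mem_chart_source H₁ x.1, mem_chart_source H₂ x.2⟩] with z hz
  have hz' : z ∈ (chartAt (ModelProd H₁ H₂) x).source := hz
  rw [extend_eq_mfderiv_symm _ hz', extend_eq_mfderiv_symm _ hz.1, extend_eq_mfderiv_symm _ hz.2]
  simp only [ModelWithCorners.range_eq_univ, mfderivWithin_univ]
  have d1 : MDifferentiableAt 𝓘(ℝ, E₁) I₁ (extChartAt I₁ x.1).symm (extChartAt I₁ x.1 z.1) := by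
    have := mdifferentiableWithinAt_extChartAt_symm (I := I₁)
      ((extChartAt I₁ x.1).map_source (by rw [extChartAt_source]; exact hz.1))
    rwa [I₁.range_eq_univ, mdifferentiableWithinAt_univ] at this
  have d2 : MDifferentiableAt 𝓘(ℝ, E₂) I₂ (extChartAt I₂ x.2).symm (extChartAt I₂ x.2 z.2) := by
    have := mdifferentiableWithinAt_extChartAt_symm (I := I₂)
      ((extChartAt I₂ x.2).map_source (by rw [extChartAt_source]; exact hz.2))
    rwa [I₂.range_eq_univ, mdifferentiableWithinAt_univ] at this
  have h := mfderiv_prodMap (p := (extChartAt I₁ x.1 z.1, extChartAt I₂ x.2 z.2)) d1 d2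
  rw [modelWithCornersSelf_prod, ← chartedSpaceSelf_prod]
  exact congrArg (fun L : E₁ × E₂ →L[ℝ] E₁ × E₂ => L (v₁, v₂)) h

/-- In product charts the slice is an affine inclusion, which contributes no second derivative. -/
theorem hessianAlong_slice_left [I₁.Boundaryless] [I₂.Boundaryless] {χ : M₁ × M₂ → X}
    (hχ : ContMDiff (I₁.prod I₂) I ∞ χ) (y : M₁) (t : M₂) (v w : TangentSpace I₁ y) :
    hessianAlong I₁ nabla (fun y => χ (y, t)) y v w =
      hessianAlong (I₁.prod I₂) nabla χ (y, t) (tangentPair (x := (y, t)) v 0)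
        (tangentPair (x := (y, t)) w 0) := by
  have hι : ContMDiff I₁ (I₁.prod I₂) ∞ (fun y : M₁ => (y, t)) :=
    contMDiff_id.prodMk contMDiff_const
  have h := hessianAlong_comp_affine (nabla := nabla) hχ hι (y' := y)
    (A := fun a : E₁ => (a, extChartAt I₂ t t)) (L := ContinuousLinearMap.inl ℝ E₁ E₂)
    (fun b => (hasFDerivAt_id b).prodMk (hasFDerivAt_const _ b))
    (fun a => by simp only [extChartAt_prod, PartialEquiv.prod_symm, PartialEquiv.prod_coe,
      extChartAt_to_inv]) (by simp only [extChartAt_prod, PartialEquiv.prod_coe])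
    (fun v => mfderiv_slice_left y t v) v w
  rwa [mfderiv_slice_left, mfderiv_slice_left] at h

theorem hessianAlong_slice_right [I₁.Boundaryless] [I₂.Boundaryless] {χ : M₁ × M₂ → X}
    (hχ : ContMDiff (I₁.prod I₂) I ∞ χ) (y : M₁) (t : M₂) (v w : TangentSpace I₂ t) :
    hessianAlong I₂ nabla (fun t => χ (y, t)) t v w =
      hessianAlong (I₁.prod I₂) nabla χ (y, t) (tangentPair (x := (y, t)) 0 v)
        (tangentPair (x := (y, t)) 0 w) := by
  have hι : ContMDiff I₂ (I₁.prod I₂) ∞ (fun t : M₂ => (y, t)) :=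
    contMDiff_const.prodMk contMDiff_id
  have h := hessianAlong_comp_affine (nabla := nabla) hχ hι (y' := t)
    (A := fun a : E₂ => (extChartAt I₁ y y, a)) (L := ContinuousLinearMap.inr ℝ E₁ E₂)
    (fun b => (hasFDerivAt_const _ b).prodMk (hasFDerivAt_id b))
    (fun a => by simp only [extChartAt_prod, PartialEquiv.prod_symm, PartialEquiv.prod_coe,
      extChartAt_to_inv]) (by simp only [extChartAt_prod, PartialEquiv.prod_coe])
    (fun v => mfderiv_slice_right y t v) v w
  rwa [mfderiv_slice_right, mfderiv_slice_right] at h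

theorem mfderiv_comp_slice_left {χ : M₁ × M₂ → X}
    (hχ : ContMDiff (I₁.prod I₂) I ∞ χ) (y : M₁) (t : M₂) (v : TangentSpace I₁ y) :
    mfderiv I₁ I (fun y => χ (y, t)) y v =
      mfderiv (I₁.prod I₂) I χ (y, t) (tangentPair (x := (y, t)) v 0) := by
  rw [← mfderiv_slice_left]
  have hι : ContMDiff I₁ (I₁.prod I₂) ∞ (fun y : M₁ => (y, t)) :=
    contMDiff_id.prodMk contMDiff_const
  exact mfderiv_comp_apply y (hχ.mdifferentiable (by simp) (y, t)) (hι.mdifferentiable (by simp) y) v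

theorem mfderiv_comp_slice_right {χ : M₁ × M₂ → X}
    (hχ : ContMDiff (I₁.prod I₂) I ∞ χ) (y : M₁) (t : M₂) (v : TangentSpace I₂ t) :
    mfderiv I₂ I (fun t => χ (y, t)) t v =
      mfderiv (I₁.prod I₂) I χ (y, t) (tangentPair (x := (y, t)) 0 v) := by
  rw [← mfderiv_slice_right]
  have hι : ContMDiff I₂ (I₁.prod I₂) ∞ (fun t : M₂ => (y, t)) :=
    contMDiff_const.prodMk contMDiff_id
  exact mfderiv_comp_apply t (hχ.mdifferentiable (by simp) (y, t)) (hι.mdifferentiable (by simp) t) v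

theorem mvfderiv_comp_fst {k : M₁ → ℝ} (hk : MDifferentiableAt I₁ 𝓘(ℝ, ℝ) k x.1)
    (v₁ : TangentSpace I₁ x.1) (v₂ : TangentSpace I₂ x.2) :
    mvfderiv (I₁.prod I₂) (fun z : M₁ × M₂ => k z.1) x (tangentPair v₁ v₂) =
      mvfderiv I₁ k x.1 v₁ := by
  have h := mvfderiv_comp_apply (f := Prod.fst) (I' := I₁.prod I₂) x hk mdifferentiableAt_fst
    (tangentPair v₁ v₂)
  rwa [mfderiv_fst_tangentPair] at h

theorem mvfderiv_comp_snd {k : M₂ → ℝ} (hk : MDifferentiableAt I₂ 𝓘(ℝ, ℝ) k x.2)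
    (v₁ : TangentSpace I₁ x.1) (v₂ : TangentSpace I₂ x.2) :
    mvfderiv (I₁.prod I₂) (fun z : M₁ × M₂ => k z.2) x (tangentPair v₁ v₂) =
      mvfderiv I₂ k x.2 v₂ := by
  have h := mvfderiv_comp_apply (f := Prod.snd) (I' := I₁.prod I₂) x hk mdifferentiableAt_snd
    (tangentPair v₁ v₂)
  rwa [mfderiv_snd_tangentPair] at h

theorem mvfderiv_log {f : M₁ → ℝ} {y : M₁} (hf : MDifferentiableAt I₁ 𝓘(ℝ, ℝ) f y) (h0 : f y ≠ 0)
    (v : TangentSpace I₁ y) :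
    mvfderiv I₁ (fun y => Real.log (f y)) y v = (f y)⁻¹ * mvfderiv I₁ f y v := by
  have hl : HasFDerivAt Real.log _ (f y) := (Real.hasDerivAt_log h0).hasFDerivAt
  have h := mvfderiv_comp_apply (f := f) (g := Real.log) y hl.differentiableAt.mdifferentiableAt hf v
  refine h.trans ?_
  have e : mvfderiv 𝓘(ℝ, ℝ) Real.log (f y) = fderiv ℝ Real.log (f y) := by
    rw [mvfderiv, mfderiv_eq_fderiv]; rfl
  rw [e, hl.fderiv]
  exact mul_comm _ _

end Product

/-! ### Covariant derivatives in a warped product -/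

section WarpedProduct

variable {E H : Type*} [NormedAddCommGroup E] [NormedSpace ℝ E] [FiniteDimensional ℝ E]
  [TopologicalSpace H] {I : ModelWithCorners ℝ E H}
  {X : Type*} [TopologicalSpace X] [ChartedSpace H X] [IsManifold I ∞ X]
  [RiemannianBundle (fun x : X => TangentSpace I x)]
  [IsContMDiffRiemannianBundle I ∞ E (fun x : X => TangentSpace I x)]
  {E₁ H₁ M₁ : Type*} [NormedAddCommGroup E₁] [NormedSpace ℝ E₁] [FiniteDimensional ℝ E₁]
  [TopologicalSpace H₁] {I₁ : ModelWithCorners ℝ E₁ H₁} [I₁.Boundaryless]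
  [TopologicalSpace M₁] [ChartedSpace H₁ M₁] [IsManifold I₁ ∞ M₁]
  [RiemannianBundle (fun x : M₁ => TangentSpace I₁ x)]
  [IsContMDiffRiemannianBundle I₁ ∞ E₁ (fun x : M₁ => TangentSpace I₁ x)]
  {E₂ H₂ M₂ : Type*} [NormedAddCommGroup E₂] [NormedSpace ℝ E₂] [FiniteDimensional ℝ E₂]
  [TopologicalSpace H₂] {I₂ : ModelWithCorners ℝ E₂ H₂} [I₂.Boundaryless]
  [TopologicalSpace M₂] [ChartedSpace H₂ M₂] [IsManifold I₂ ∞ M₂]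
  [RiemannianBundle (fun x : M₂ => TangentSpace I₂ x)]
  [IsContMDiffRiemannianBundle I₂ ∞ E₂ (fun x : M₂ => TangentSpace I₂ x)]
  {nabla : CovariantDerivative I E (fun x : X => TangentSpace I x)}
  {f : M₁ → ℝ} {χ : M₁ × M₂ → X} {x : M₁ × M₂}

theorem MDifferentiableAt.inner_extend (v w : TangentSpace I₁ x.1) :
    MDifferentiableAt I₁ 𝓘(ℝ, ℝ) (fun z => (inner ℝ (FiberBundle.extend E₁ v z)
      (FiberBundle.extend E₁ w z) : ℝ)) x.1 :=
  MDiffAlongAt.inner (ψ := fun y : M₁ => y) (mdifferentiableAt_extend_tangent v)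
    (mdifferentiableAt_extend_tangent w)

namespace IsWarpedProductImmersion

theorem inner_tangentPair (hχ : IsWarpedProductImmersion (I := I) I₁ I₂ f χ)
    (v₁ w₁ : TangentSpace I₁ x.1) (v₂ w₂ : TangentSpace I₂ x.2) :
    (inner ℝ (mfderiv (I₁.prod I₂) I χ x (tangentPair v₁ v₂))
      (mfderiv (I₁.prod I₂) I χ x (tangentPair w₁ w₂)) : ℝ) =
      inner ℝ v₁ w₁ + f x.1 ^ 2 * inner ℝ v₂ w₂ := by
  rw [hχ.isometric]
  simp only [mfderiv_fst_tangentPair, mfderiv_snd_tangentPair]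

theorem inner_pushExtend (hχ : IsWarpedProductImmersion (I := I) I₁ I₂ f χ)
    (v₁ w₁ : TangentSpace I₁ x.1) (v₂ w₂ : TangentSpace I₂ x.2) :
    (fun z => (inner ℝ (pushExtend I (I₁.prod I₂) χ (tangentPair v₁ v₂) z)
      (pushExtend I (I₁.prod I₂) χ (tangentPair w₁ w₂) z) : ℝ)) =ᶠ[nhds x]
    fun z => (inner ℝ (FiberBundle.extend E₁ v₁ z.1) (FiberBundle.extend E₁ w₁ z.1) : ℝ) +
      f z.1 ^ 2 * inner ℝ (FiberBundle.extend E₂ v₂ z.2) (FiberBundle.extend E₂ w₂ z.2) := by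
  filter_upwards [extend_tangentPair v₁ v₂, extend_tangentPair w₁ w₂] with z hv hw
  rw [pushExtend, pushExtend, hv, hw, hχ.inner_tangentPair]

/-- The factors stay orthogonal at every point near `x`, so all derivatives of the mixed products in
the Koszul formula vanish. -/
theorem inner_pushExtend_left_right (hχ : IsWarpedProductImmersion (I := I) I₁ I₂ f χ)
    (v₁ : TangentSpace I₁ x.1) (w₂ : TangentSpace I₂ x.2) :
    (fun z => (inner ℝ (pushExtend I (I₁.prod I₂) χ (tangentPair v₁ (0 : TangentSpace I₂ x.2)) z)
      (pushExtend I (I₁.prod I₂) χ (tangentPair (0 : TangentSpace I₁ x.1) w₂) z) : ℝ)) =ᶠ[nhds x]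
    fun _ => 0 := by
  have h1 := (eventually_mem_baseSet (I := I₁) (ψ := fun z : M₁ × M₂ => z.1) (y := x)
    continuous_fst.continuousAt)
  have h2 := (eventually_mem_baseSet (I := I₂) (ψ := fun z : M₁ × M₂ => z.2) (y := x)
    continuous_snd.continuousAt)
  filter_upwards [hχ.inner_pushExtend v₁ 0 0 w₂, h1, h2] with z hz hz1 hz2
  rw [hz, extend_eq_symmL (0 : TangentSpace I₁ x.1) hz1, extend_eq_symmL (0 : TangentSpace I₂ x.2) hz2]
  simp

theorem inner_pushExtend_left (hχ : IsWarpedProductImmersion (I := I) I₁ I₂ f χ)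
    (v₁ w₁ : TangentSpace I₁ x.1) :
    (fun z => (inner ℝ (pushExtend I (I₁.prod I₂) χ (tangentPair v₁ (0 : TangentSpace I₂ x.2)) z)
      (pushExtend I (I₁.prod I₂) χ (tangentPair w₁ (0 : TangentSpace I₂ x.2)) z) : ℝ)) =ᶠ[nhds x]
    fun z => (inner ℝ (FiberBundle.extend E₁ v₁ z.1) (FiberBundle.extend E₁ w₁ z.1) : ℝ) := by
  have h2 := (eventually_mem_baseSet (I := I₂) (ψ := fun z : M₁ × M₂ => z.2) (y := x)
    continuous_snd.continuousAt)
  filter_upwards [hχ.inner_pushExtend v₁ w₁ 0 0, h2] with z hz hz2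
  rw [hz, extend_eq_symmL (0 : TangentSpace I₂ x.2) hz2]
  simp

theorem inner_pushExtend_right (hχ : IsWarpedProductImmersion (I := I) I₁ I₂ f χ)
    (v₂ w₂ : TangentSpace I₂ x.2) :
    (fun z => (inner ℝ (pushExtend I (I₁.prod I₂) χ (tangentPair (0 : TangentSpace I₁ x.1) v₂) z)
      (pushExtend I (I₁.prod I₂) χ (tangentPair (0 : TangentSpace I₁ x.1) w₂) z) : ℝ)) =ᶠ[nhds x]
    fun z => (f z.1 * f z.1) *
      (inner ℝ (FiberBundle.extend E₂ v₂ z.2) (FiberBundle.extend E₂ w₂ z.2) : ℝ) := by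
  have h1 := (eventually_mem_baseSet (I := I₁) (ψ := fun z : M₁ × M₂ => z.1) (y := x)
    continuous_fst.continuousAt)
  filter_upwards [hχ.inner_pushExtend 0 0 v₂ w₂, h1] with z hz hz1
  rw [hz, extend_eq_symmL (0 : TangentSpace I₁ x.1) hz1]
  simp [pow_two]

/-- Along the base only the factor `f²` varies, and `d(f²) = 2 f² d(ln f)`. -/
theorem mvfderiv_inner_right (hχ : IsWarpedProductImmersion (I := I) I₁ I₂ f χ)
    (u₁ : TangentSpace I₁ x.1) (v₂ w₂ : TangentSpace I₂ x.2) :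
    mvfderiv (I₁.prod I₂)
      (fun z => (inner ℝ (pushExtend I (I₁.prod I₂) χ (tangentPair (0 : TangentSpace I₁ x.1) v₂) z)
        (pushExtend I (I₁.prod I₂) χ (tangentPair (0 : TangentSpace I₁ x.1) w₂) z) : ℝ)) x
        (tangentPair u₁ 0) =
      2 * (mvfderiv I₁ (fun y => Real.log (f y)) x.1 u₁ * (f x.1 ^ 2 * inner ℝ v₂ w₂)) := by
  have hf : MDifferentiableAt I₁ 𝓘(ℝ, ℝ) f x.1 := hχ.contMDiff_f.mdifferentiable (by simp) _
  have hf' : MDifferentiableAt (I₁.prod I₂) 𝓘(ℝ, ℝ) (fun z : M₁ × M₂ => f z.1) x :=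
    hf.comp x mdifferentiableAt_fst
  have hff : MDifferentiableAt (I₁.prod I₂) 𝓘(ℝ, ℝ) (fun z : M₁ × M₂ => f z.1 * f z.1) x :=
    hf'.mul hf'
  have hk : MDifferentiableAt I₂ 𝓘(ℝ, ℝ) (fun z => (inner ℝ (FiberBundle.extend E₂ v₂ z)
      (FiberBundle.extend E₂ w₂ z) : ℝ)) x.2 :=
    MDifferentiableAt.inner_extend (x := (x.2, x.1)) v₂ w₂
  have hk' : MDifferentiableAt (I₁.prod I₂) 𝓘(ℝ, ℝ)
      (fun z : M₁ × M₂ => (inner ℝ (FiberBundle.extend E₂ v₂ z.2)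
      (FiberBundle.extend E₂ w₂ z.2) : ℝ)) x := hk.comp x mdifferentiableAt_snd
  rw [mvfderiv_congr (hχ.inner_pushExtend_right v₂ w₂), mvfderiv_fun_mul hff hk',
    mvfderiv_fun_mul hf' hf']
  simp only [add_apply, smul_apply, mvfderiv_comp_fst hf, mvfderiv_comp_snd hk, map_zero,
    FiberBundle.extend_apply_self, smul_eq_mul, mvfderiv_log hf (hχ.f_pos x.1).ne']
  have := (hχ.f_pos x.1).ne'
  field_simp
  ring

theorem mvfderiv_inner_left (hχ : IsWarpedProductImmersion (I := I) I₁ I₂ f χ)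
    (v₁ w₁ : TangentSpace I₁ x.1) (u₂ : TangentSpace I₂ x.2) :
    mvfderiv (I₁.prod I₂)
      (fun z => (inner ℝ (pushExtend I (I₁.prod I₂) χ (tangentPair v₁ (0 : TangentSpace I₂ x.2)) z)
        (pushExtend I (I₁.prod I₂) χ (tangentPair w₁ (0 : TangentSpace I₂ x.2)) z) : ℝ)) x
        (tangentPair 0 u₂) = 0 := by
  rw [mvfderiv_congr (hχ.inner_pushExtend_left v₁ w₁),
    mvfderiv_comp_fst (MDifferentiableAt.inner_extend v₁ w₁), map_zero]

theorem mvfderiv_inner_left_right (hχ : IsWarpedProductImmersion (I := I) I₁ I₂ f χ)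
    (v₁ : TangentSpace I₁ x.1) (w₂ : TangentSpace I₂ x.2) (u : TangentSpace (I₁.prod I₂) x) :
    mvfderiv (I₁.prod I₂)
      (fun z => (inner ℝ (pushExtend I (I₁.prod I₂) χ (tangentPair v₁ (0 : TangentSpace I₂ x.2)) z)
        (pushExtend I (I₁.prod I₂) χ (tangentPair (0 : TangentSpace I₁ x.1) w₂) z) : ℝ)) x u = 0 := by
  rw [mvfderiv_congr (hχ.inner_pushExtend_left_right v₁ w₂), mvfderiv_const]
  rfl

theorem mvfderiv_inner_right_left (hχ : IsWarpedProductImmersion (I := I) I₁ I₂ f χ)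
    (v₁ : TangentSpace I₁ x.1) (w₂ : TangentSpace I₂ x.2) (u : TangentSpace (I₁.prod I₂) x) :
    mvfderiv (I₁.prod I₂)
      (fun z => (inner ℝ (pushExtend I (I₁.prod I₂) χ (tangentPair (0 : TangentSpace I₁ x.1) w₂) z)
        (pushExtend I (I₁.prod I₂) χ (tangentPair v₁ (0 : TangentSpace I₂ x.2)) z) : ℝ)) x u = 0 := by
  rw [← hχ.mvfderiv_inner_left_right v₁ w₂ u]
  simp only [real_inner_comm]

/-- The component in `TM₁` of the covariant derivative of vector fields of `M₂`. -/
theorem inner_hessianAlong_right_right (hχ : IsWarpedProductImmersion (I := I) I₁ I₂ f χ)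
    (hnabla : IsRiemannianConnection nabla)
    (u₁ : TangentSpace I₁ x.1) (v₂ w₂ : TangentSpace I₂ x.2) :
    (inner ℝ (hessianAlong (I₁.prod I₂) nabla χ x (tangentPair 0 v₂) (tangentPair 0 w₂))
      (mfderiv (I₁.prod I₂) I χ x (tangentPair u₁ 0)) : ℝ) =
    -(mvfderiv I₁ (fun y => Real.log (f y)) x.1 u₁ * (f x.1 ^ 2 * inner ℝ v₂ w₂)) := by
  have h := two_inner_hessianAlong hnabla hχ.contMDiff (tangentPair u₁ (0 : TangentSpace I₂ x.2))
    (tangentPair 0 v₂) (tangentPair 0 w₂)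
  rw [hχ.mvfderiv_inner_right_left, hχ.mvfderiv_inner_right_left, hχ.mvfderiv_inner_right] at h
  linarith

/-- The leaves of the base are totally geodesic in the warped product: two Koszul terms are mixed
products, and the third differentiates the base metric along the fibre. -/
theorem inner_hessianAlong_left_left (hχ : IsWarpedProductImmersion (I := I) I₁ I₂ f χ)
    (hnabla : IsRiemannianConnection nabla)
    (v₁ w₁ : TangentSpace I₁ x.1) (u₂ : TangentSpace I₂ x.2) :
    (inner ℝ (hessianAlong (I₁.prod I₂) nabla χ x (tangentPair v₁ 0) (tangentPair w₁ 0))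
      (mfderiv (I₁.prod I₂) I χ x (tangentPair 0 u₂)) : ℝ) = 0 := by
  have h := two_inner_hessianAlong hnabla hχ.contMDiff (tangentPair (0 : TangentSpace I₁ x.1) u₂)
    (tangentPair v₁ 0) (tangentPair w₁ 0)
  rw [hχ.mvfderiv_inner_left_right, hχ.mvfderiv_inner_left_right, hχ.mvfderiv_inner_left] at h
  linarith

/-- The fibre component of `∇_v U` is `U(ln f) v`. -/
theorem inner_hessianAlong_right_left (hχ : IsWarpedProductImmersion (I := I) I₁ I₂ f χ)
    (hnabla : IsRiemannianConnection nabla)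
    (u₁ : TangentSpace I₁ x.1) (v₂ w₂ : TangentSpace I₂ x.2) :
    (inner ℝ (hessianAlong (I₁.prod I₂) nabla χ x (tangentPair 0 v₂) (tangentPair u₁ 0))
      (mfderiv (I₁.prod I₂) I χ x (tangentPair 0 w₂)) : ℝ) =
    mvfderiv I₁ (fun y => Real.log (f y)) x.1 u₁ * (f x.1 ^ 2 * inner ℝ v₂ w₂) := by
  have h := two_inner_hessianAlong hnabla hχ.contMDiff (tangentPair (0 : TangentSpace I₁ x.1) w₂)
    (tangentPair 0 v₂) (tangentPair u₁ 0)
  rw [hχ.mvfderiv_inner_left_right, hχ.mvfderiv_inner_right_left, hχ.mvfderiv_inner_right] at h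
  linarith

end IsWarpedProductImmersion

end WarpedProduct

/-! ### Invariant vectors, second fundamental form and umbilicity -/

section Submanifold

variable {E H : Type*} [NormedAddCommGroup E] [NormedSpace ℝ E] [FiniteDimensional ℝ E]
  [TopologicalSpace H] {I : ModelWithCorners ℝ E H}
  {X : Type*} [TopologicalSpace X] [ChartedSpace H X] [IsManifold I ∞ X]
  [RiemannianBundle (fun x : X => TangentSpace I x)]
  {F G N : Type*} [NormedAddCommGroup F] [NormedSpace ℝ F] [TopologicalSpace G]
  {J : ModelWithCorners ℝ F G}
  [TopologicalSpace N] [ChartedSpace G N] [IsManifold J ∞ N]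
  {nabla : CovariantDerivative I E (fun x : X => TangentSpace I x)}
  {S : AlmostContactMetricStructure I X} {ψ : N → X} {y : N}

namespace AlmostContactMetricStructure

theorem norm_sq_φ (x : X) (v : TangentSpace I x) :
    ‖S.φ x v‖ ^ 2 = ‖v‖ ^ 2 - S.η x v ^ 2 := by
  rw [← real_inner_self_eq_norm_sq, ← real_inner_self_eq_norm_sq, S.inner_φ_φ]
  ring

theorem norm_φ_le (x : X) (v : TangentSpace I x) : ‖S.φ x v‖ ≤ ‖v‖ :=
  (pow_le_pow_iff_left₀ (norm_nonneg _) (norm_nonneg _) two_ne_zero).1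
    (by rw [norm_sq_φ]; nlinarith [sq_nonneg (S.η x v)])

end AlmostContactMetricStructure

theorem norm_tangentialPart_le (v : TangentSpace I (ψ y)) :
    ‖tangentialPart J S ψ y v‖ ≤ ‖S.φ (ψ y) v‖ :=
  Submodule.norm_starProjection_apply_le _ _

/-- The vectors with `P² v = -v` are orthogonal to `ξ` and `φ` preserves them. -/
theorem φ_mem_eigenDistribution_one {v : TangentSpace I (ψ y)}
    (hv : v ∈ eigenDistribution J S ψ 1 y) :
    S.η (ψ y) v = 0 ∧ S.φ (ψ y) v ∈ eigenDistribution J S ψ 1 y := by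
  obtain ⟨-, hv⟩ := hv
  rw [one_pow, one_smul] at hv
  set P := tangentialPart J S ψ y with hP
  -- The chain `‖v‖ = ‖P²v‖ ≤ ‖Pv‖ ≤ ‖φv‖ ≤ ‖v‖` collapses. Projection does not shorten `φv`, so
  -- `φv` is tangent; and `‖φv‖ = ‖v‖` forces `η(v) = 0`.
  have h1 : ‖v‖ = ‖P (P v)‖ := by rw [hv, norm_neg]
  have h2 : ‖P (P v)‖ ≤ ‖P v‖ := (norm_tangentialPart_le _).trans (S.norm_φ_le _ _)
  have h3 : ‖P v‖ ≤ ‖S.φ (ψ y) v‖ := norm_tangentialPart_le v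
  have h4 : ‖S.φ (ψ y) v‖ ≤ ‖v‖ := S.norm_φ_le _ _
  have h5 : ‖P v‖ = ‖S.φ (ψ y) v‖ := by linarith
  have h6 : S.φ (ψ y) v ∈ tangentImage I J ψ y :=
    ((tangentImage I J ψ y).mem_iff_norm_starProjection _).2 h5
  have h7 : P v = S.φ (ψ y) v := Submodule.starProjection_eq_self_iff.2 h6
  have h8 : ‖S.φ (ψ y) v‖ = ‖v‖ := by linarith
  refine ⟨?_, h6, ?_⟩
  · have := S.norm_sq_φ (ψ y) v
    rw [h8] at this
    exact pow_eq_zero_iff two_ne_zero |>.1 (by linarith)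
  · rw [← hP, ← h7, hv, map_neg, one_pow, one_smul]

theorem secondFundamentalForm_eq (v w : TangentSpace J y) :
    secondFundamentalForm J nabla ψ y v w =
      (tangentImage I J ψ y)ᗮ.starProjection (hessianAlong J nabla ψ y v w) := rfl

theorem secondFundamentalForm_eq_zero_iff (v w : TangentSpace J y) :
    secondFundamentalForm J nabla ψ y v w = 0 ↔
      hessianAlong J nabla ψ y v w ∈ tangentImage I J ψ y := by
  rw [secondFundamentalForm_eq, Submodule.starProjection_apply_eq_zero_iff,
    Submodule.orthogonal_orthogonal]

theorem mfderiv_orthonormalFrame (i : Fin (finrank ℝ (tangentImage I J ψ y))) :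
    mfderiv J I ψ y (orthonormalFrame I J ψ y i) =
      stdOrthonormalBasis ℝ (tangentImage I J ψ y) i :=
  Classical.choose_spec (stdOrthonormalBasis ℝ (tangentImage I J ψ y) i).2

/-- The frame is specified only through its images under `dψ`, so injectivity is what lets the
expansion be pulled back. -/
theorem exists_sum_orthonormalFrame (hinj : Function.Injective (mfderiv J I ψ y))
    (v : TangentSpace J y) :
    ∃ c : Fin (finrank ℝ (tangentImage I J ψ y)) → ℝ, v = ∑ i, c i • orthonormalFrame I J ψ y i := by
  have hv : mfderiv J I ψ y v ∈ tangentImage I J ψ y := ⟨v, rfl⟩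
  refine ⟨fun i => (stdOrthonormalBasis ℝ (tangentImage I J ψ y)).repr ⟨_, hv⟩ i, hinj ?_⟩
  rw [map_sum]
  simp only [map_smul, mfderiv_orthonormalFrame]
  have := congrArg Subtype.val
    ((stdOrthonormalBasis ℝ (tangentImage I J ψ y)).sum_repr ⟨mfderiv J I ψ y v, hv⟩)
  exact this.symm.trans (by simp)

theorem normSqSecondFundamentalForm_nonneg : 0 ≤ normSqSecondFundamentalForm J nabla ψ y :=
  Finset.sum_nonneg fun _ _ => Finset.sum_nonneg fun _ _ => sq_nonneg _

theorem hessianAlong_sum_left {ι : Type*} (s : Finset ι) (c : ι → ℝ) (e : ι → TangentSpace J y)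
    (w : TangentSpace J y) :
    hessianAlong J nabla ψ y (∑ i ∈ s, c i • e i) w =
      ∑ i ∈ s, c i • hessianAlong J nabla ψ y (e i) w := by
  let L : TangentSpace J y →ₗ[ℝ] TangentSpace I (ψ y) :=
    { toFun := fun v => hessianAlong J nabla ψ y v w
      map_add' := fun v v' => hessianAlong_add_left v v' w
      map_smul' := fun c v => hessianAlong_smul_left c v w }
  have : L (∑ i ∈ s, c i • e i) = ∑ i ∈ s, c i • L (e i) := by simp only [map_sum, map_smul]
  exact this

/-- A vanishing sum of squares kills `h` on the frame; linearity in the first slot and symmetry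
extend this to all vectors. -/
theorem secondFundamentalForm_eq_zero_of_normSq [J.Boundaryless]
    (hnabla : IsRiemannianConnection nabla) (hψ : ContMDiff J I ∞ ψ)
    (hinj : Function.Injective (mfderiv J I ψ y))
    (h : normSqSecondFundamentalForm J nabla ψ y = 0) (v w : TangentSpace J y) :
    secondFundamentalForm J nabla ψ y v w = 0 := by
  have h1 : ∀ i j, hessianAlong J nabla ψ y (orthonormalFrame I J ψ y i)
      (orthonormalFrame I J ψ y j) ∈ tangentImage I J ψ y := by
    intro i j
    rw [← secondFundamentalForm_eq_zero_iff, ← norm_eq_zero, ← sq_eq_zero_iff]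
    have h2 := (Finset.sum_eq_zero_iff_of_nonneg
      (fun i _ => Finset.sum_nonneg fun _ _ => sq_nonneg _)).1 h i (Finset.mem_univ i)
    exact (Finset.sum_eq_zero_iff_of_nonneg (fun _ _ => sq_nonneg _)).1 h2 j (Finset.mem_univ j)
  rw [secondFundamentalForm_eq_zero_iff]
  obtain ⟨c, rfl⟩ := exists_sum_orthonormalFrame hinj v
  rw [hessianAlong_sum_left]
  refine Submodule.sum_mem _ fun i _ => Submodule.smul_mem _ _ ?_
  rw [hessianAlong_symm hnabla hψ]
  obtain ⟨d, rfl⟩ := exists_sum_orthonormalFrame hinj w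
  rw [hessianAlong_sum_left]
  exact Submodule.sum_mem _ fun j _ => Submodule.smul_mem _ _ (h1 j i)

/-- Taking the trace over an orthonormal frame identifies `ν` with the mean curvature. -/
theorem isTotallyUmbilical_of_exists
    (h : ∀ y, ∃ ν : TangentSpace I (ψ y), ∀ v w, secondFundamentalForm J nabla ψ y v w =
      (inner ℝ (mfderiv J I ψ y v) (mfderiv J I ψ y w) : ℝ) • ν) :
    IsTotallyUmbilical J nabla ψ := by
  intro y v w
  obtain ⟨ν, hν⟩ := h y
  rw [hν]
  -- In dimension zero the trace does not determine `ν`, but then both sides are zero because `dψ v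
  -- = 0`.
  by_cases hn : finrank ℝ (tangentImage I J ψ y) = 0
  · have : tangentImage I J ψ y = ⊥ := Submodule.finrank_eq_zero.1 hn
    have hv : mfderiv J I ψ y v ∈ tangentImage I J ψ y := ⟨v, rfl⟩
    rw [this, Submodule.mem_bot] at hv
    rw [hv, inner_zero_left, zero_smul, zero_smul]
  · have hH : meanCurvature J nabla ψ y = ν := by
      have h1 : ∀ i, (inner ℝ (mfderiv J I ψ y (orthonormalFrame I J ψ y i))
          (mfderiv J I ψ y (orthonormalFrame I J ψ y i)) : ℝ) = 1 := by
        intro i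
        have h2 : ‖(stdOrthonormalBasis ℝ (tangentImage I J ψ y) i : TangentSpace I (ψ y))‖ = 1 :=
          (stdOrthonormalBasis ℝ (tangentImage I J ψ y)).orthonormal.1 i
        rw [mfderiv_orthonormalFrame, real_inner_self_eq_norm_sq, h2, one_pow]
      have hn' : (finrank ℝ (tangentImage I J ψ y) : ℝ) ≠ 0 := Nat.cast_ne_zero.2 hn
      simp only [meanCurvature, hν, h1, one_smul, Finset.sum_const, Finset.card_univ,
        Fintype.card_fin]
      rw [← Nat.cast_smul_eq_nsmul ℝ, smul_smul, one_div, inv_mul_cancel₀ hn', one_smul]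
    rw [hH]

end Submanifold

/-! ### The gradient as dual of the differential -/

section Gradient

variable {E H : Type*} [NormedAddCommGroup E] [NormedSpace ℝ E] [FiniteDimensional ℝ E]
  [TopologicalSpace H] {I : ModelWithCorners ℝ E H}
  {X : Type*} [TopologicalSpace X] [ChartedSpace H X]
  [RiemannianBundle (fun x : X => TangentSpace I x)]

theorem inner_riemannianGradient (u : X → ℝ) (x : X) (v : TangentSpace I x) :
    (inner ℝ (riemannianGradient I u x) v : ℝ) = mvfderiv I u x v := by
  have : CompleteSpace (TangentSpace I x) := FiniteDimensional.complete ℝ _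
  exact InnerProductSpace.toDual_symm_apply

end Gradient

/-! ### Leaves of a warped product, and the gradient of `ln f` in a Kenmotsu manifold -/

section WarpedProduct

variable {E H : Type*} [NormedAddCommGroup E] [NormedSpace ℝ E] [FiniteDimensional ℝ E]
  [TopologicalSpace H] {I : ModelWithCorners ℝ E H}
  {X : Type*} [TopologicalSpace X] [ChartedSpace H X] [IsManifold I ∞ X]
  [RiemannianBundle (fun x : X => TangentSpace I x)]
  [IsContMDiffRiemannianBundle I ∞ E (fun x : X => TangentSpace I x)]
  {E₁ H₁ M₁ : Type*} [NormedAddCommGroup E₁] [NormedSpace ℝ E₁] [FiniteDimensional ℝ E₁]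
  [TopologicalSpace H₁] {I₁ : ModelWithCorners ℝ E₁ H₁} [I₁.Boundaryless]
  [TopologicalSpace M₁] [ChartedSpace H₁ M₁] [IsManifold I₁ ∞ M₁]
  [RiemannianBundle (fun x : M₁ => TangentSpace I₁ x)]
  [IsContMDiffRiemannianBundle I₁ ∞ E₁ (fun x : M₁ => TangentSpace I₁ x)]
  {E₂ H₂ M₂ : Type*} [NormedAddCommGroup E₂] [NormedSpace ℝ E₂] [FiniteDimensional ℝ E₂]
  [TopologicalSpace H₂] {I₂ : ModelWithCorners ℝ E₂ H₂} [I₂.Boundaryless]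
  [TopologicalSpace M₂] [ChartedSpace H₂ M₂] [IsManifold I₂ ∞ M₂]
  [RiemannianBundle (fun x : M₂ => TangentSpace I₂ x)]
  [IsContMDiffRiemannianBundle I₂ ∞ E₂ (fun x : M₂ => TangentSpace I₂ x)]
  {nabla : CovariantDerivative I E (fun x : X => TangentSpace I x)}
  {f : M₁ → ℝ} {χ : M₁ × M₂ → X}

namespace IsWarpedProductImmersion

theorem injective_mfderiv (hχ : IsWarpedProductImmersion (I := I) I₁ I₂ f χ) (x : M₁ × M₂) :
    Function.Injective (mfderiv (I₁.prod I₂) I χ x) := by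
  rw [injective_iff_map_eq_zero]
  intro v hv
  obtain ⟨v₁, v₂, rfl⟩ := exists_tangentPair v
  have h := hχ.inner_tangentPair v₁ v₁ v₂ v₂
  rw [hv, inner_zero_left, real_inner_self_eq_norm_sq, real_inner_self_eq_norm_sq] at h
  have hf := hχ.f_pos x.1
  have h1 : ‖v₁‖ ^ 2 = 0 := by nlinarith [sq_nonneg ‖v₁‖, mul_nonneg (sq_nonneg (f x.1)) (sq_nonneg ‖v₂‖)]
  rw [h1, zero_add] at h
  have h2 : ‖v₂‖ ^ 2 = 0 := (mul_eq_zero.1 h.symm).resolve_left (pow_pos hf 2).ne'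
  rw [norm_eq_zero.1 (sq_eq_zero_iff.1 h1), norm_eq_zero.1 (sq_eq_zero_iff.1 h2), tangentPair_zero]

/-- If a warped product is totally geodesic then so are the leaves of its first factor. -/
theorem isTotallyGeodesic_left (hχ : IsWarpedProductImmersion (I := I) I₁ I₂ f χ)
    (hnabla : IsRiemannianConnection nabla) (h : IsTotallyGeodesic (I₁.prod I₂) nabla χ) (t : M₂) :
    IsTotallyGeodesic I₁ nabla (fun y => χ (y, t)) := by
  intro y v w
  rw [secondFundamentalForm_eq_zero_iff, hessianAlong_slice_left hχ.contMDiff]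
  obtain ⟨u, hu⟩ := (secondFundamentalForm_eq_zero_iff _ _).1 (h (y, t)
    (tangentPair (x := (y, t)) v 0) (tangentPair (x := (y, t)) w 0))
  obtain ⟨u₁, u₂, rfl⟩ := exists_tangentPair u
  replace hu : mfderiv (I₁.prod I₂) I χ (y, t) (tangentPair (x := (y, t)) u₁ u₂) =
    hessianAlong (I₁.prod I₂) nabla χ (y, t) (tangentPair (x := (y, t)) v 0)
      (tangentPair (x := (y, t)) w 0) := hu
  -- Testing against the fibre component `u₂` itself gives `f² ‖u₂‖² = 0`, so the Hessian is tangent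
  -- to the leaf.
  have h1 := hχ.inner_hessianAlong_left_left hnabla (x := (y, t)) v w u₂
  rw [← hu, hχ.inner_tangentPair, inner_zero_right, zero_add, real_inner_self_eq_norm_sq] at h1
  have h2 := (mul_eq_zero.1 h1).resolve_left (pow_pos (hχ.f_pos y) 2).ne'
  rw [norm_eq_zero.1 (sq_eq_zero_iff.1 h2)] at hu
  exact ⟨u₁, (mfderiv_comp_slice_left hχ.contMDiff y t u₁).trans hu⟩

/-- If a warped product is totally geodesic then the leaves of its second factor are totally
umbilical. -/
theorem isTotallyUmbilical_right (hχ : IsWarpedProductImmersion (I := I) I₁ I₂ f χ)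
    (hnabla : IsRiemannianConnection nabla) (h : IsTotallyGeodesic (I₁.prod I₂) nabla χ) (y : M₁) :
    IsTotallyUmbilical I₂ nabla (fun t => χ (y, t)) := by
  refine isTotallyUmbilical_of_exists fun t => ?_
  set n := riemannianGradient I₁ (fun y => Real.log (f y)) y with hn
  -- The mean curvature vector of a fibre is minus the gradient of `ln f`.
  refine ⟨-mfderiv (I₁.prod I₂) I χ (y, t) (tangentPair (x := (y, t)) n 0), fun v w => ?_⟩
  rw [secondFundamentalForm_eq, hessianAlong_slice_right hχ.contMDiff]
  obtain ⟨u, hu⟩ := (secondFundamentalForm_eq_zero_iff _ _).1 (h (y, t)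
    (tangentPair (x := (y, t)) 0 v) (tangentPair (x := (y, t)) 0 w))
  obtain ⟨u₁, u₂, rfl⟩ := exists_tangentPair u
  replace hu : mfderiv (I₁.prod I₂) I χ (y, t) (tangentPair (x := (y, t)) u₁ u₂) =
    hessianAlong (I₁.prod I₂) nabla χ (y, t) (tangentPair (x := (y, t)) 0 v)
      (tangentPair (x := (y, t)) 0 w) := hu
  have hvw : (inner ℝ (mfderiv I₂ I (fun t => χ (y, t)) t v)
      (mfderiv I₂ I (fun t => χ (y, t)) t w) : ℝ) = f y ^ 2 * inner ℝ v w := by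
    rw [mfderiv_comp_slice_right hχ.contMDiff, mfderiv_comp_slice_right hχ.contMDiff,
      hχ.inner_tangentPair (x := (y, t)), inner_zero_left, zero_add]
  have hu₁ : u₁ = (-(f y ^ 2 * inner ℝ v w)) • n := by
    refine ext_inner_right ℝ fun z => ?_
    have h1 := hχ.inner_hessianAlong_right_right hnabla (x := (y, t)) z v w
    rw [← hu, hχ.inner_tangentPair, inner_zero_right, mul_zero, add_zero] at h1
    rw [h1, real_inner_smul_left, hn, inner_riemannianGradient]
    ring
  -- The base component of the Hessian is normal to the fibre and survives the projection; the fibre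
  -- component is tangent and is annihilated.
  have hK : mfderiv (I₁.prod I₂) I χ (y, t) (tangentPair (x := (y, t)) u₁ 0) ∈
      (tangentImage I I₂ (fun t => χ (y, t)) t)ᗮ := by
    rw [Submodule.mem_orthogonal]
    rintro _ ⟨z, rfl⟩
    have := hχ.inner_tangentPair (x := (y, t)) 0 u₁ z 0
    rw [inner_zero_left, inner_zero_right, mul_zero, zero_add] at this
    rw [← this]
    exact congrArg (fun a => (inner ℝ a _ : ℝ)) (mfderiv_comp_slice_right hχ.contMDiff y t z)
  have hK' : mfderiv (I₁.prod I₂) I χ (y, t) (tangentPair (x := (y, t)) 0 u₂) ∈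
      (tangentImage I I₂ (fun t => χ (y, t)) t) :=
    ⟨u₂, mfderiv_comp_slice_right hχ.contMDiff y t u₂⟩
  have hsplit : tangentPair (x := (y, t)) u₁ u₂ =
      tangentPair (x := (y, t)) u₁ 0 + tangentPair (x := (y, t)) 0 u₂ := by
    rw [← tangentPair_add, add_zero, zero_add]
  rw [hvw, ← hu, hsplit, map_add, map_add, Submodule.starProjection_eq_self_iff.2 hK,
    (Submodule.starProjection_apply_eq_zero_iff _).2
      (by rwa [Submodule.orthogonal_orthogonal]), add_zero, hu₁]
  have : tangentPair (x := (y, t)) ((-(f y ^ 2 * inner ℝ v w)) • n) (0 : TangentSpace I₂ t) =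
      (-(f y ^ 2 * inner ℝ v w)) • tangentPair (x := (y, t)) n 0 := by
    rw [← tangentPair_smul, smul_zero]
  rw [this, map_smul, neg_smul, smul_neg]

/-- If the second factor of a warped product in a Kenmotsu manifold is invariant and orthogonal
to `ξ` and is not a point, then `ξ` is the gradient of `ln f` on the first factor. -/
theorem mvfderiv_log_eq_η (hχ : IsWarpedProductImmersion (I := I) I₁ I₂ f χ)
    (hnabla : IsRiemannianConnection nabla) {S : AlmostContactMetricStructure I X}
    (hS : S.IsKenmotsu nabla)
    (hη : ∀ (x : M₁ × M₂) (v : TangentSpace I₂ x.2),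
      S.η (χ x) (mfderiv (I₁.prod I₂) I χ x (tangentPair 0 v)) = 0)
    (hφ : ∀ (x : M₁ × M₂) (v : TangentSpace I₂ x.2), ∃ w : TangentSpace I₂ x.2,
      mfderiv (I₁.prod I₂) I χ x (tangentPair 0 w) =
        S.φ (χ x) (mfderiv (I₁.prod I₂) I χ x (tangentPair 0 v)))
    (x : M₁ × M₂) {v : TangentSpace I₂ x.2} (hv : v ≠ 0) (u : TangentSpace I₁ x.1) :
    mvfderiv I₁ (fun y => Real.log (f y)) x.1 u =
      S.η (χ x) (mfderiv (I₁.prod I₂) I χ x (tangentPair u 0)) := by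
  set d := mvfderiv I₁ (fun y => Real.log (f y)) x.1 u with hd
  let D : TangentSpace I₂ x.2 → TangentSpace I (χ x) := fun v =>
    mfderiv (I₁.prod I₂) I χ x (tangentPair 0 v)
  let U : TangentSpace I (χ x) := mfderiv (I₁.prod I₂) I χ x (tangentPair u 0)
  -- Obtained by differentiating `g(φW, U) = 0` along `v`; the left summand is symmetric in `v`, `w`
  -- and the right one is skew.
  have key : ∀ v w : TangentSpace I₂ x.2,
      (inner ℝ (S.φ (χ x) (hessianAlong (I₁.prod I₂) nabla χ x (tangentPair 0 v) (tangentPair 0 w)))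
        U : ℝ) + inner ℝ (S.φ (χ x) (D v)) (D w) * (S.η (χ x) U - d) = 0 := by
    intro v w
    have hW := mdiffAlongAt_pushExtend hχ.contMDiff (tangentPair (0 : TangentSpace I₁ x.1) w)
    have hU := mdiffAlongAt_pushExtend hχ.contMDiff (tangentPair u (0 : TangentSpace I₂ x.2))
    have h0 : (fun z => (inner ℝ (S.φ (χ z) (pushExtend I (I₁.prod I₂) χ
        (tangentPair (0 : TangentSpace I₁ x.1) w) z)) (pushExtend I (I₁.prod I₂) χ
          (tangentPair u (0 : TangentSpace I₂ x.2)) z) : ℝ)) =ᶠ[nhds x] fun _ => 0 := by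
      have h1 := (eventually_mem_baseSet (I := I₁) (ψ := fun z : M₁ × M₂ => z.1) (y := x)
        continuous_fst.continuousAt)
      have h2 := (eventually_mem_baseSet (I := I₂) (ψ := fun z : M₁ × M₂ => z.2) (y := x)
        continuous_snd.continuousAt)
      filter_upwards [extend_tangentPair (0 : TangentSpace I₁ x.1) w,
        extend_tangentPair u (0 : TangentSpace I₂ x.2), h1, h2] with z hz1 hz2 hz3 hz4
      rw [pushExtend, pushExtend, hz1, hz2, extend_eq_symmL (0 : TangentSpace I₁ x.1) hz3,
        extend_eq_symmL (0 : TangentSpace I₂ x.2) hz4]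
      simp only [map_zero]
      obtain ⟨w', hw'⟩ := hφ z (FiberBundle.extend E₂ w z.2)
      rw [← hw', hχ.inner_tangentPair, inner_zero_left, inner_zero_right, mul_zero, zero_add]
    have h1 := mvfderiv_inner_along hnabla (hW.map_φ S) hU (tangentPair 0 v)
    rw [mvfderiv_congr h0, mvfderiv_const, hS.covDerivAlong_φ hW, pushExtend_self,
      pushExtend_self, hη, zero_smul, sub_zero] at h1
    obtain ⟨w', hw'⟩ := hφ x w
    have h2 : (inner ℝ (D w') (hessianAlong (I₁.prod I₂) nabla χ x (tangentPair 0 v)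
        (tangentPair u 0)) : ℝ) = d * inner ℝ (D v) (D w') := by
      rw [real_inner_comm, hχ.inner_hessianAlong_right_left hnabla, hχ.inner_tangentPair,
        inner_zero_left, zero_add]
    have h3 : (inner ℝ (D v) (D w') : ℝ) = - inner ℝ (S.φ (χ x) (D v)) (D w) := by
      rw [S.inner_φ_left, neg_neg]
      exact congrArg _ hw'
    rw [← hw', inner_add_left, real_inner_smul_left] at h1
    have h4 : (inner ℝ (S.ξ (χ x)) U : ℝ) = S.η (χ x) U := by
      rw [S.η_eq, real_inner_comm]
    have h5 : (0 : ℝ) = inner ℝ (S.φ (χ x) (hessianAlong (I₁.prod I₂) nabla χ x (tangentPair 0 v)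
        (tangentPair 0 w))) U + inner ℝ (S.φ (χ x) (D v)) (D w) * inner ℝ (S.ξ (χ x)) U +
        inner ℝ (D w') (hessianAlong (I₁.prod I₂) nabla χ x (tangentPair 0 v)
        (tangentPair u 0)) := h1
    rw [h2, h3, h4] at h5
    linarith
  -- With `w` representing `φv`, subtracting the two instances of `key` cancels the symmetric part
  -- and leaves twice `‖φv‖² (η(U) - U(ln f))`.
  obtain ⟨w, hw⟩ := hφ x v
  have k1 := key v w
  have k2 := key w v
  rw [hessianAlong_symm hnabla hχ.contMDiff, S.inner_φ_left (χ x) (D w)] at k2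
  have hDw : D w = S.φ (χ x) (D v) := hw
  rw [hDw] at k1 k2
  -- Since `η` vanishes on the fibre, `φ` preserves the norm there, and the immersion is injective
  -- on tangent vectors.
  have hne : (inner ℝ (S.φ (χ x) (D v)) (S.φ (χ x) (D v)) : ℝ) ≠ 0 := by
    rw [S.inner_φ_φ]
    have h1 : S.η (χ x) (D v) = 0 := hη x v
    rw [h1, zero_mul, sub_zero, inner_self_ne_zero]
    intro h2
    have h3 := hχ.injective_mfderiv x (h2.trans (map_zero _).symm)
    exact hv (congrArg (mfderiv (I₁.prod I₂) I₂ Prod.snd x) h3 |> fun h => by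
      rwa [mfderiv_snd_tangentPair, map_zero] at h)
  have h6 : (inner ℝ (S.φ (χ x) (D v)) (S.φ (χ x) (D v)) : ℝ) * (S.η (χ x) U - d) = 0 := by
    linarith
  linarith [(mul_eq_zero.1 h6).resolve_left hne]

end IsWarpedProductImmersion

end WarpedProduct

/-! ### The gradient of `ln f` on a skew CR warped product -/

section SkewCR

variable {E H : Type*} [NormedAddCommGroup E] [NormedSpace ℝ E] [FiniteDimensional ℝ E]
  [TopologicalSpace H] {I : ModelWithCorners ℝ E H}
  {X : Type*} [TopologicalSpace X] [ChartedSpace H X] [IsManifold I ∞ X]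
  [RiemannianBundle (fun x : X => TangentSpace I x)]
  [IsContMDiffRiemannianBundle I ∞ E (fun x : X => TangentSpace I x)]
  {Ep Hp Mp : Type*} [NormedAddCommGroup Ep] [NormedSpace ℝ Ep] [FiniteDimensional ℝ Ep]
  [TopologicalSpace Hp] {Ip : ModelWithCorners ℝ Ep Hp} [Ip.Boundaryless]
  [TopologicalSpace Mp] [ChartedSpace Hp Mp] [IsManifold Ip ∞ Mp]
  {Eθ Hθ Mθ : Type*} [NormedAddCommGroup Eθ] [NormedSpace ℝ Eθ] [FiniteDimensional ℝ Eθ]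
  [TopologicalSpace Hθ] {Iθ : ModelWithCorners ℝ Eθ Hθ} [Iθ.Boundaryless]
  [TopologicalSpace Mθ] [ChartedSpace Hθ Mθ] [IsManifold Iθ ∞ Mθ]
  [RiemannianBundle (fun y : Mp × Mθ => TangentSpace (Ip.prod Iθ) y)]
  [IsContMDiffRiemannianBundle (Ip.prod Iθ) ∞ (Ep × Eθ)
    (fun y : Mp × Mθ => TangentSpace (Ip.prod Iθ) y)]
  {Et Ht Mt : Type*} [NormedAddCommGroup Et] [NormedSpace ℝ Et] [FiniteDimensional ℝ Et]
  [TopologicalSpace Ht] {It : ModelWithCorners ℝ Et Ht} [It.Boundaryless]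
  [TopologicalSpace Mt] [ChartedSpace Ht Mt] [IsManifold It ∞ Mt]
  [RiemannianBundle (fun t : Mt => TangentSpace It t)]
  [IsContMDiffRiemannianBundle It ∞ Et (fun t : Mt => TangentSpace It t)]
  {nabla : CovariantDerivative I E (fun x : X => TangentSpace I x)}
  {S : AlmostContactMetricStructure I X} {θ : ℝ}
  {f : Mp × Mθ → ℝ} {χ : (Mp × Mθ) × Mt → X}

namespace IsSkewCRProduct

theorem η_eq_zero (hskew : IsSkewCRProduct Ip Iθ It S θ χ)
    (hχ : ContMDiff ((Ip.prod Iθ).prod It) I ∞ χ) (x : (Mp × Mθ) × Mt) (v : TangentSpace It x.2) :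
    S.η (χ x) (mfderiv ((Ip.prod Iθ).prod It) I χ x (tangentPair 0 v)) = 0 := by
  obtain ⟨⟨a, b⟩, t⟩ := x
  have h : mfderiv ((Ip.prod Iθ).prod It) I χ ((a, b), t) (tangentPair (x := ((a, b), t)) 0 v) ∈
      tangentImage I It (fun t' => χ ((a, b), t')) t :=
    ⟨v, mfderiv_comp_slice_right hχ (a, b) t v⟩
  rw [hskew.tangent_t] at h
  exact (φ_mem_eigenDistribution_one h).1

theorem exists_φ_eq (hskew : IsSkewCRProduct Ip Iθ It S θ χ)
    (hχ : ContMDiff ((Ip.prod Iθ).prod It) I ∞ χ) (x : (Mp × Mθ) × Mt) (v : TangentSpace It x.2) :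
    ∃ w : TangentSpace It x.2,
      mfderiv ((Ip.prod Iθ).prod It) I χ x (tangentPair 0 w) =
        S.φ (χ x) (mfderiv ((Ip.prod Iθ).prod It) I χ x (tangentPair 0 v)) := by
  obtain ⟨⟨a, b⟩, t⟩ := x
  have h : mfderiv ((Ip.prod Iθ).prod It) I χ ((a, b), t) (tangentPair (x := ((a, b), t)) 0 v) ∈
      tangentImage I It (fun t' => χ ((a, b), t')) t :=
    ⟨v, mfderiv_comp_slice_right hχ (a, b) t v⟩
  rw [hskew.tangent_t] at h
  have h1 := (φ_mem_eigenDistribution_one h).2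
  rw [← hskew.tangent_t] at h1
  obtain ⟨w, hw⟩ := h1
  exact ⟨w, (mfderiv_comp_slice_right hχ (a, b) t w).symm.trans hw⟩

/-- Provides the vector of the slant factor that turns out to be the gradient of `ln f`. -/
theorem exists_eq_ξ (hskew : IsSkewCRProduct Ip Iθ It S θ χ)
    (hχ : ContMDiff ((Ip.prod Iθ).prod It) I ∞ χ) (a : Mp) (b : Mθ) (t : Mt) :
    ∃ ζ : TangentSpace Iθ b, mfderiv ((Ip.prod Iθ).prod It) I χ ((a, b), t)
      (tangentPair (x := ((a, b), t)) (tangentPair (x := (a, b)) 0 ζ) 0) = S.ξ (χ ((a, b), t)) := by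
  have h : S.ξ (χ ((a, b), t)) ∈ tangentImage I Iθ (fun b' => χ ((a, b'), t)) b := by
    rw [hskew.tangent_θ]
    exact Submodule.mem_sup_right (Submodule.mem_span_singleton_self _)
  obtain ⟨ζ, hζ⟩ := h
  refine ⟨ζ, ?_⟩
  have hι : ContMDiff (Ip.prod Iθ) ((Ip.prod Iθ).prod It) ∞ (fun y : Mp × Mθ => (y, t)) :=
    contMDiff_id.prodMk contMDiff_const
  rw [← mfderiv_comp_slice_left hχ,
    ← mfderiv_comp_slice_right (χ := fun y : Mp × Mθ => χ (y, t)) (hχ.comp hι)]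
  exact hζ

theorem inner_ξ_eq_zero (hskew : IsSkewCRProduct Ip Iθ It S θ χ)
    (hχ : ContMDiff ((Ip.prod Iθ).prod It) I ∞ χ) (a : Mp) (b : Mθ) (t : Mt)
    (v : TangentSpace Ip a) :
    (inner ℝ (S.ξ (χ ((a, b), t))) (mfderiv ((Ip.prod Iθ).prod It) I χ ((a, b), t)
      (tangentPair (x := ((a, b), t)) (tangentPair (x := (a, b)) v 0) 0)) : ℝ) = 0 := by
  have hι : ContMDiff (Ip.prod Iθ) ((Ip.prod Iθ).prod It) ∞ (fun y : Mp × Mθ => (y, t)) :=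
    contMDiff_id.prodMk contMDiff_const
  have h : mfderiv ((Ip.prod Iθ).prod It) I χ ((a, b), t)
      (tangentPair (x := ((a, b), t)) (tangentPair (x := (a, b)) v 0) 0) ∈
      tangentImage I Ip (fun a' => χ ((a', b), t)) a := by
    refine ⟨v, ?_⟩
    rw [← mfderiv_comp_slice_left hχ,
      ← mfderiv_comp_slice_left (χ := fun y : Mp × Mθ => χ (y, t)) (hχ.comp hι)]
    rfl
  rw [hskew.tangent_p] at h
  exact Submodule.mem_orthogonal_singleton_iff_inner_right.1 h.2

/-- If the invariant factor is not a point, then `ln f` has no gradient along the anti-invariant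
factor, and the gradient along the slant factor is the unit vector `ξ`. -/
theorem normSqGradientAlong_log (hskew : IsSkewCRProduct Ip Iθ It S θ χ)
    (hχ : IsWarpedProductImmersion (I := I) (Ip.prod Iθ) It f χ)
    (hnabla : IsRiemannianConnection nabla) (hS : S.IsKenmotsu nabla) (a : Mp) (b : Mθ) (t : Mt)
    [Nontrivial (TangentSpace It t)] :
    normSqGradientAlong (Ip.prod Iθ) Ip (fun y => Real.log (f y)) (fun a' : Mp => (a', b)) a = 0 ∧
    normSqGradientAlong (Ip.prod Iθ) Iθ (fun y => Real.log (f y)) (fun b' : Mθ => (a, b')) b =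
      1 := by
  obtain ⟨v, hv⟩ := exists_ne (0 : TangentSpace It t)
  obtain ⟨ζ, hζ⟩ := hskew.exists_eq_ξ hχ.contMDiff a b t
  -- As the immersion is isometric, pairing with the lift of `ξ` on the base is pairing with `ξ` in
  -- the ambient manifold, where it computes `η`.
  have hinner : ∀ u : TangentSpace (Ip.prod Iθ) (a, b),
      (inner ℝ (tangentPair (x := (a, b)) (0 : TangentSpace Ip a) ζ) u : ℝ) =
        inner ℝ (S.ξ (χ ((a, b), t))) (mfderiv ((Ip.prod Iθ).prod It) I χ ((a, b), t)
          (tangentPair (x := ((a, b), t)) u 0)) := by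
    intro u
    rw [← hζ, hχ.inner_tangentPair (x := ((a, b), t)), inner_zero_left, mul_zero, add_zero]
  have hgrad : riemannianGradient (Ip.prod Iθ) (fun y => Real.log (f y)) (a, b) =
      tangentPair (x := (a, b)) 0 ζ := by
    refine ext_inner_right ℝ fun u => ?_
    rw [inner_riemannianGradient, hinner, real_inner_comm, ← S.η_eq]
    exact hχ.mvfderiv_log_eq_η hnabla hS (hskew.η_eq_zero hχ.contMDiff)
      (hskew.exists_φ_eq hχ.contMDiff) ((a, b), t) hv u
  constructor
  · have : gradientAlong (Ip.prod Iθ) Ip (fun y => Real.log (f y)) (fun a' : Mp => (a', b)) a =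
        0 := by
      rw [gradientAlong, hgrad, Submodule.starProjection_apply_eq_zero_iff,
        Submodule.mem_orthogonal']
      rintro _ ⟨v, rfl⟩
      refine (congrArg (fun u => (inner ℝ (tangentPair (x := (a, b)) (0 : TangentSpace Ip a) ζ) u
        : ℝ)) (mfderiv_slice_left (I₁ := Ip) (I₂ := Iθ) a b v)).trans ?_
      exact (hinner _).trans (hskew.inner_ξ_eq_zero hχ.contMDiff a b t v)
    rw [normSqGradientAlong, this, norm_zero, zero_pow two_ne_zero]
  · have : gradientAlong (Ip.prod Iθ) Iθ (fun y => Real.log (f y)) (fun b' : Mθ => (a, b')) b =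
        tangentPair (x := (a, b)) 0 ζ := by
      rw [gradientAlong, hgrad]
      exact Submodule.starProjection_eq_self_iff.2
        ⟨ζ, mfderiv_slice_right (I₁ := Ip) (I₂ := Iθ) a b ζ⟩
    rw [normSqGradientAlong, this, ← real_inner_self_eq_norm_sq]
    refine (hinner _).trans ?_
    rw [hζ, ← S.η_eq, S.η_ξ]

end IsSkewCRProduct

end SkewCR

end

/-! ### The inequality and its equality case -/

theorem theorem6p1 {m p q s : ℕ} {θ : ℝ} (hθ₀ : 0 < θ) (hθ₁ : θ < Real.pi / 2)
    {X : Type*} [TopologicalSpace X] [T2Space X] [SecondCountableTopology X]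
    [ChartedSpace (EuclideanSpace ℝ (Fin (2 * m + 1))) X] [IsManifold (𝓡 (2 * m + 1)) ∞ X]
    [RiemannianBundle (fun x : X => TangentSpace (𝓡 (2 * m + 1)) x)]
    [IsContMDiffRiemannianBundle (𝓡 (2 * m + 1)) ∞ (EuclideanSpace ℝ (Fin (2 * m + 1)))
      (fun x : X => TangentSpace (𝓡 (2 * m + 1)) x)]
    (nabla : CovariantDerivative (𝓡 (2 * m + 1)) (EuclideanSpace ℝ (Fin (2 * m + 1)))
      (fun x : X => TangentSpace (𝓡 (2 * m + 1)) x))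
    (hnabla : IsRiemannianConnection nabla)
    (S : AlmostContactMetricStructure (𝓡 (2 * m + 1)) X) (hS : S.IsKenmotsu nabla)
    {Mp : Type*} [TopologicalSpace Mp] [T2Space Mp] [SecondCountableTopology Mp]
    [ChartedSpace (EuclideanSpace ℝ (Fin q)) Mp] [IsManifold (𝓡 q) ∞ Mp]
    {Mθ : Type*} [TopologicalSpace Mθ] [T2Space Mθ] [SecondCountableTopology Mθ]
    [ChartedSpace (EuclideanSpace ℝ (Fin (2 * s + 1))) Mθ] [IsManifold (𝓡 (2 * s + 1)) ∞ Mθ]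
    [RiemannianBundle (fun y : Mp × Mθ => TangentSpace ((𝓡 q).prod (𝓡 (2 * s + 1))) y)]
    [IsContMDiffRiemannianBundle ((𝓡 q).prod (𝓡 (2 * s + 1))) ∞
      (EuclideanSpace ℝ (Fin q) × EuclideanSpace ℝ (Fin (2 * s + 1)))
      (fun y : Mp × Mθ => TangentSpace ((𝓡 q).prod (𝓡 (2 * s + 1))) y)]
    {Mt : Type*} [TopologicalSpace Mt] [T2Space Mt] [SecondCountableTopology Mt]
    [ChartedSpace (EuclideanSpace ℝ (Fin (2 * p))) Mt] [IsManifold (𝓡 (2 * p)) ∞ Mt]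
    [RiemannianBundle (fun t : Mt => TangentSpace (𝓡 (2 * p)) t)]
    [IsContMDiffRiemannianBundle (𝓡 (2 * p)) ∞ (EuclideanSpace ℝ (Fin (2 * p)))
      (fun t : Mt => TangentSpace (𝓡 (2 * p)) t)]
    (f : Mp × Mθ → ℝ) (χ : (Mp × Mθ) × Mt → X)
    (hχ : IsWarpedProductImmersion (I := 𝓡 (2 * m + 1))
      ((𝓡 q).prod (𝓡 (2 * s + 1))) (𝓡 (2 * p)) f χ)
    (hskew : IsSkewCRProduct (𝓡 q) (𝓡 (2 * s + 1)) (𝓡 (2 * p)) S θ χ) :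
    (∀ x : (Mp × Mθ) × Mt,
      2 * (p : ℝ) *
        (normSqGradientAlong ((𝓡 q).prod (𝓡 (2 * s + 1))) (𝓡 q)
            (fun y => Real.log (f y)) (fun a : Mp => (a, x.1.2)) x.1.1
          + ((1 / Real.sin θ) ^ 2 + Real.cot θ ^ 2) *
            (normSqGradientAlong ((𝓡 q).prod (𝓡 (2 * s + 1))) (𝓡 (2 * s + 1))
              (fun y => Real.log (f y)) (fun b : Mθ => (x.1.1, b)) x.1.2 - 1))
        ≤ normSqSecondFundamentalForm (((𝓡 q).prod (𝓡 (2 * s + 1))).prod (𝓡 (2 * p)))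
            nabla χ x) ∧
    ((∀ x : (Mp × Mθ) × Mt,
      normSqSecondFundamentalForm (((𝓡 q).prod (𝓡 (2 * s + 1))).prod (𝓡 (2 * p))) nabla χ x =
      2 * (p : ℝ) *
        (normSqGradientAlong ((𝓡 q).prod (𝓡 (2 * s + 1))) (𝓡 q)
            (fun y => Real.log (f y)) (fun a : Mp => (a, x.1.2)) x.1.1
          + ((1 / Real.sin θ) ^ 2 + Real.cot θ ^ 2) *
            (normSqGradientAlong ((𝓡 q).prod (𝓡 (2 * s + 1))) (𝓡 (2 * s + 1))
              (fun y => Real.log (f y)) (fun b : Mθ => (x.1.1, b)) x.1.2 - 1))) →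
      (∀ t : Mt, IsTotallyGeodesic ((𝓡 q).prod (𝓡 (2 * s + 1))) nabla (fun y => χ (y, t))) ∧
      (∀ y : Mp × Mθ, IsTotallyUmbilical (𝓡 (2 * p)) nabla (fun t => χ (y, t)))) := by
  -- The bound is zero at every point: through the factor `2p` when `p = 0`, and through `∇ ln f =
  -- ξ` otherwise.
  have hB : ∀ x : (Mp × Mθ) × Mt,
      2 * (p : ℝ) *
        (normSqGradientAlong ((𝓡 q).prod (𝓡 (2 * s + 1))) (𝓡 q)
            (fun y => Real.log (f y)) (fun a : Mp => (a, x.1.2)) x.1.1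
          + ((1 / Real.sin θ) ^ 2 + Real.cot θ ^ 2) *
            (normSqGradientAlong ((𝓡 q).prod (𝓡 (2 * s + 1))) (𝓡 (2 * s + 1))
              (fun y => Real.log (f y)) (fun b : Mθ => (x.1.1, b)) x.1.2 - 1)) = 0 := by
    rintro ⟨⟨a, b⟩, t⟩
    rcases Nat.eq_zero_or_pos p with rfl | hp
    · simp
    · have : NeZero (2 * p) := ⟨by omega⟩
      -- A nonzero vector tangent to the invariant factor is needed to identify the gradient with
      -- `ξ`.
      have : Nontrivial (TangentSpace (𝓡 (2 * p)) t) :=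
        inferInstanceAs (Nontrivial (EuclideanSpace ℝ (Fin (2 * p))))
      obtain ⟨h1, h2⟩ := hskew.normSqGradientAlong_log hχ hnabla hS a b t
      rw [h1, h2, sub_self, mul_zero, add_zero, mul_zero]
  refine ⟨fun x => (hB x).le.trans normSqSecondFundamentalForm_nonneg, fun heq => ?_⟩
  have hgeo : IsTotallyGeodesic (((𝓡 q).prod (𝓡 (2 * s + 1))).prod (𝓡 (2 * p))) nabla χ :=
    fun x => secondFundamentalForm_eq_zero_of_normSq hnabla hχ.contMDiff (hχ.injective_mfderiv x)
      ((heq x).trans (hB x))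
  exact ⟨hχ.isTotallyGeodesic_left hnabla hgeo, hχ.isTotallyUmbilical_right hnabla hgeo⟩
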